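/- Let $\mathbb F_q$ be a finite field with $q$ elements, of characteristic different from $2$, and let $E$ be an elliptic curve over $\mathbb F_q$ such that $4 \mid \# E(\mathbb F_q)$. Put $a_q = q+1-\#E(\mathbb F_q)$. (1) If $a_q \ne \pm 2\sqrt q$ (that is, $a_q \neq 2\sqrt q$ and $a_q \neq -2\sqrt q$), then there exist elliptic curves $E'$ and $E''$ over $\mathbb F_q$, both $\mathbb F_q$-isogenous to $E$, with $E'(\mathbb F_q)[2] \simeq C_2$ and $E''(\mathbb F_q)[2] \simeq C_2 \oplus C_2$. (2) If $a_q = 2\sqrt q$ or $a_q = -2\sqrt q$, then every elliptic curve $E'$ over $\mathbb F_q$ that is $\mathbb F_q$-isogenous to $E$ satisfies $E'(\mathbb F_q)[2] \simeq C_2 \oplus C_2$. Here $C_2$ is the cyclic group of order $2$, $A[2]$ is the subgroup of elements of an abelian group $A$ killed by $2$, and an $\mathbb F_q$-isogeny is a homomorphism of algebraic groups defined over $\mathbb F_q$ that is surjective on $\overline{\mathbb F}_q$-points and has finite kernel. -/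

import Mathlib

namespace EllipticIsogeny

/-- Homogeneous coordinates `[x : y : 1]` of an affine point of a Weierstrass curve, and
`[0 : 1 : 0]` for the point at infinity. -/
def homCoords {K : Type*} [Field K] {W : WeierstrassCurve K} : W.toAffine.Point → Fin 3 → K
  | .zero => ![0, 1, 0]
  | .some x y _ => ![x, y, 1]

/-- The geometric points `W(F̄)` of a Weierstrass curve `W` over `F`. -/
abbrev GeomPoint {F : Type*} [Field F] (W : WeierstrassCurve F) : Type _ :=
  (W.baseChange (AlgebraicClosure F)).toAffine.Point

/-- The map `φ : W(F̄) → W'(F̄)` is a morphism of projective plane curves defined over `F`: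
around every geometric point `P` it is given by a triple of homogeneous polynomials of the same
degree with coefficients in `F`, not all vanishing at `P`. -/
def IsMorphismOver {F : Type*} [Field F] (W W' : WeierstrassCurve F)
    (φ : GeomPoint W → GeomPoint W') : Prop :=
  ∀ P : GeomPoint W, ∃ (d : ℕ) (f : Fin 3 → MvPolynomial (Fin 3) F),
    (∀ i, (f i).IsHomogeneous d) ∧
    (∃ i, MvPolynomial.aeval (homCoords P) (f i) ≠ 0) ∧
    ∀ Q : GeomPoint W, (∃ i, MvPolynomial.aeval (homCoords Q) (f i) ≠ 0) →
      ∃ c : AlgebraicClosure F, c ≠ 0 ∧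
        ∀ i, homCoords (φ Q) i = c * MvPolynomial.aeval (homCoords Q) (f i)

open scoped Classical in
/-- An isogeny over `F`: a homomorphism of algebraic groups defined over `F` which is surjective
on geometric points and has finite kernel. -/
structure IsIsogeny {F : Type*} [Field F] (W W' : WeierstrassCurve F)
    (φ : GeomPoint W →+ GeomPoint W') : Prop where
  isMorphismOver : IsMorphismOver W W' φ
  surjective : Function.Surjective φ
  finite_ker : (φ.ker : Set (GeomPoint W)).Finite

open scoped Classical in
/-- `W'` is `F`-isogenous to `W`. -/
def Isogenous {F : Type*} [Field F] (W W' : WeierstrassCurve F) : Prop :=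
  ∃ φ : GeomPoint W →+ GeomPoint W', IsIsogeny W W' φ

/-- The number `a_q = q + 1 - #W(𝔽_q)`. -/
noncomputable def frobeniusTrace {F : Type*} [Field F] [Fintype F] (W : WeierstrassCurve F) : ℤ :=
  (Fintype.card F : ℤ) + 1 - (Nat.card W.toAffine.Point : ℤ)

/-- The rational 2-torsion subgroup `W(F)[2]`. -/
abbrev ratTwoTorsion {F : Type*} [Field F] [DecidableEq F] (W : WeierstrassCurve F) :
    AddSubgroup W.toAffine.Point :=
  AddSubgroup.torsionBy W.toAffine.Point 2

end EllipticIsogeny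

/-! Let π be the q-power Frobenius on geometric points and a the trace. A curve is called full if π
fixes all its geometric 2-torsion. Isogenies over the base field commute with π
(`IsMorphismOver.frob_comm`), so the problem concerns the action of π on 2-power torsion.

A full curve in the class: if E is not full, the divisibility by 4 makes its only rational point T
of order two the double of a rational point R. On E/⟨T⟩ a 2-torsion point is the image of some Q
with 2Q = 0 or 2Q = T, and after subtracting R in the second case πQ - Q lies in {0, T}. Hence E/⟨T⟩
is full (`exists_isogenous_isFull`).

A curve that is not full, when a² ≠ 4q: suppose every isogenous curve with a rational point of order
two is full. Repeated quotients by such points show that π preserves each cyclic group of 2-power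
order (`frob_mem_zmultiples_of_forall_isFull`), so π is a scalar s on the 2^k-torsion
(`exists_zsmul_eq_of_forall_mem_zmultiples`), with |s| ≤ 2^k / 2. Then π - s kills 4^k points,
whereas its kernel has at most about 2(s² - as + 2q) ≤ 4^k / 2 + O(2^k) elements
(`ncard_ker_frob_add_le`), which is absurd for large k.

The case a² = 4q: with a = 2m the degree of π - m is zero, so π = m (`exists_frob_eq_zsmul`). As m
is odd, π is trivial on 2-torsion, and this passes through isogenies.

All degrees come from deg(π + n) = n² + an + q (`exists_xRepresents_frob_add`). The degree is that
of the rational function giving the x-coordinate; it obeys the parallelogram law (`XRepresents.add`)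
because x(P+Q) and x(P-Q) have symmetric functions given by quadratic forms without common zero. The
initial values are deg π = q and deg(π - 1) = #E(𝔽_q), the latter by an explicit computation
(`exists_frobSubNum_eq`). -/

namespace EllipticIsogeny

open Polynomial WeierstrassCurve WeierstrassCurve.Affine

/-! ### Symmetric functions of x(P+Q) and x(P-Q) -/

section SymmetricSquare

variable {K : Type*} [Field K] {W : WeierstrassCurve K}

/-- The square of `2y + a₁x + a₃` in terms of `x`. -/
lemma sq_psi {x y : K} (h : W.toAffine.Equation x y) :
    (2 * y + W.a₁ * x + W.a₃) ^ 2 = 4 * x ^ 3 + W.b₂ * x ^ 2 + 2 * W.b₄ * x + W.b₆ := by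
  rw [equation_iff] at h
  simp only [b₂, b₄, b₆]
  linear_combination 4 * h

lemma two_torsion_iff (x y : K) :
    y = W.toAffine.negY x y ↔ 2 * y + W.a₁ * x + W.a₃ = 0 := by
  rw [negY]
  constructor <;> intro h <;> linear_combination h

lemma eval_addSubMap_zero (v : Fin 3 → K) : (W.addSubMap 0).eval v =
    v 0 ^ 2 - W.b₄ * v 0 * v 2 - W.b₆ * v 1 * v 2 - W.b₈ * v 2 ^ 2 := by
  simp [addSubMap]

lemma eval_addSubMap_one (v : Fin 3 → K) : (W.addSubMap 1).eval v =
    2 * v 1 * v 0 + W.b₂ * v 0 * v 2 + W.b₄ * v 1 * v 2 + W.b₆ * v 2 ^ 2 := by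
  simp [addSubMap]

lemma eval_addSubMap_two (v : Fin 3 → K) : (W.addSubMap 2).eval v =
    v 1 ^ 2 - 4 * v 0 * v 2 := by
  simp [addSubMap]

variable [DecidableEq K]

/-- In the coordinate ψ = 2y + a₁x + a₃ negation of a point is a change of sign, so one formula
serves both P + Q and P - Q. -/
lemma four_addX {x₁ x₂ y₁ y₂ : K} (hx : x₁ ≠ x₂) :
    4 * (x₁ - x₂) ^ 2 * W.toAffine.addX x₁ x₂ (W.toAffine.slope x₁ x₂ y₁ y₂) =
      ((2 * y₁ + W.a₁ * x₁ + W.a₃) - (2 * y₂ + W.a₁ * x₂ + W.a₃)) ^ 2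
        - (x₁ - x₂) ^ 2 * (W.b₂ + 4 * x₁ + 4 * x₂) := by
  have : x₁ - x₂ ≠ 0 := sub_ne_zero.2 hx
  rw [slope_of_X_ne hx, addX, b₂]
  field_simp
  ring

/-- On the diagonal the tangent replaces the chord; this case also supplies the equation for halving
a point. -/
lemma sym2x_add_sub_self [W.IsElliptic] (P : W.toAffine.Point) :
    ∃ c : K, c ≠ 0 ∧ ∀ i, (W.addSubMap i).eval (P.sym2x P) = c * (P + P).sym2x 0 i := by
  have hne := W.addSubMap_ne_zero (P.sym2x_ne_zero P)
  rcases P with _ | ⟨x, y, h⟩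
  · refine ⟨1, one_ne_zero, fun i ↦ ?_⟩
    fin_cases i <;> simp [eval_addSubMap_zero, eval_addSubMap_one, eval_addSubMap_two, ← Point.zero_def]
  have hpsi := sq_psi h.1
  have hb := W.b_relation
  by_cases hy : y = W.toAffine.negY x y
  · rw [Point.add_self_of_Y_eq hy]
    rw [two_torsion_iff] at hy
    rw [hy] at hpsi
    refine ⟨(W.addSubMap 0).eval ((Point.some x y h).sym2x (Point.some x y h)), fun h0 ↦ hne ?_, ?_⟩
    rotate_left
    · intro i
      fin_cases i
      · simp
      · simp [eval_addSubMap_one]; linear_combination -hpsi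
      · simp [eval_addSubMap_two]; ring
    · ext i
      fin_cases i
      · exact h0
      · simp [eval_addSubMap_one]; linear_combination -hpsi
      · simp [eval_addSubMap_two]; ring
  · rw [Point.add_self_of_Y_ne hy]
    have hs := slope_of_Y_ne (W := W.toAffine) rfl hy
    have hy' : 2 * y + W.a₁ * x + W.a₃ ≠ 0 := by rwa [Ne, ← two_torsion_iff]
    have hd : y - W.toAffine.negY x y = 2 * y + W.a₁ * x + W.a₃ := by rw [negY]; ring
    rw [hd] at hs
    refine ⟨(2 * y + W.a₁ * x + W.a₃) ^ 2, pow_ne_zero _ hy', ?_⟩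
    intro i
    fin_cases i
    · have he := (equation_iff ..).1 h.1
      have : (2 * y + W.a₁ * x + W.a₃) ^ 2 * W.toAffine.addX x x (W.toAffine.slope x x y y) =
          (3 * x ^ 2 + 2 * W.a₂ * x + W.a₄ - W.a₁ * y) ^ 2 +
          W.a₁ * (3 * x ^ 2 + 2 * W.a₂ * x + W.a₄ - W.a₁ * y) * (2 * y + W.a₁ * x + W.a₃)
           - (W.a₂ + 2 * x) * (2 * y + W.a₁ * x + W.a₃) ^ 2 := by
        rw [hs, addX]
        field_simp
        ring
      simp [eval_addSubMap_zero, -addX]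
      rw [this]
      simp only [b₄, b₆, b₈]
      linear_combination (8 * x + 4 * W.a₂ + W.a₁ ^ 2) * he
    · simp [eval_addSubMap_one]; linear_combination -hpsi
    · simp [eval_addSubMap_two]; ring

/-- The map `addSubMap` sends `(x(P)x(Q) : x(P)+x(Q) : 1)` to
`(x(P+Q)x(P-Q) : x(P+Q)+x(P-Q) : 1)`. -/
theorem sym2x_add_sub [W.IsElliptic] (h2 : (2 : K) ≠ 0) (P Q : W.toAffine.Point) :
    ∃ c : K, c ≠ 0 ∧ ∀ i, (W.addSubMap i).eval (P.sym2x Q) = c * (P + Q).sym2x (P - Q) i := by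
  by_cases hPQ : P = Q
  · subst hPQ; simpa using sym2x_add_sub_self P
  by_cases hPQ' : P = -Q
  · subst hPQ'
    obtain ⟨c, hc, h⟩ := sym2x_add_sub_self (-Q)
    refine ⟨c, hc, fun i ↦ ?_⟩
    rw [neg_add_cancel, Point.sym2x_comm, sub_eq_add_neg, Point.sym2x_comm 0, ← h i, Point.sym2x_neg_right, Point.sym2x_neg_right,
      Point.sym2x_neg_left]
  rcases P with _ | ⟨x₁, y₁, h₁⟩ <;> rcases Q with _ | ⟨x₂, y₂, h₂⟩
  · exact absurd rfl hPQ
  · rw [← Point.zero_def, zero_add, zero_sub, Point.sym2x_neg_right]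
    refine ⟨1, one_ne_zero, fun i ↦ ?_⟩
    fin_cases i <;> simp [eval_addSubMap_zero, eval_addSubMap_one, eval_addSubMap_two]
    all_goals ring
  · rw [← Point.zero_def, add_zero, sub_zero]
    refine ⟨1, one_ne_zero, fun i ↦ ?_⟩
    fin_cases i <;> simp [eval_addSubMap_zero, eval_addSubMap_one, eval_addSubMap_two]
    all_goals ring
  have hx : x₁ ≠ x₂ := fun hx ↦ (Point.X_eq_iff.1 hx).elim hPQ hPQ'
  have hx' := sub_ne_zero.2 hx
  rw [sub_eq_add_neg, Point.neg_some, Point.add_of_X_ne hx, Point.add_of_X_ne hx,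
    Point.sym2x_some_some, Point.sym2x_some_some]
  refine ⟨(x₁ - x₂) ^ 2, pow_ne_zero _ hx', ?_⟩
  have p₁ := sq_psi h₁.1
  have p₂ := sq_psi h₂.1
  have h4 : (4 : K) ≠ 0 := by
    rw [show (4 : K) = 2 * 2 by norm_num]; exact mul_ne_zero h2 h2
  have h16 : (16 : K) ≠ 0 := by
    rw [show (16 : K) = 4 * 4 by norm_num]; exact mul_ne_zero h4 h4
  have hX₁ := four_addX (W := W) (y₁ := y₁) (y₂ := y₂) hx
  have hX₂ := four_addX (W := W) (y₁ := y₁) (y₂ := W.toAffine.negY x₂ y₂) hx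
  have hn : 2 * W.toAffine.negY x₂ y₂ + W.a₁ * x₂ + W.a₃ = - (2 * y₂ + W.a₁ * x₂ + W.a₃) := by
    rw [negY]; ring
  rw [hn] at hX₂
  set X₁ := W.toAffine.addX x₁ x₂ (W.toAffine.slope x₁ x₂ y₁ y₂)
  set X₂ := W.toAffine.addX x₁ x₂ (W.toAffine.slope x₁ x₂ y₁ (W.toAffine.negY x₂ y₂))
  clear_value X₁ X₂
  generalize 2 * y₁ + W.a₁ * x₁ + W.a₃ = u at *
  generalize 2 * y₂ + W.a₁ * x₂ + W.a₃ = v at *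
  intro i
  fin_cases i
  · simp [eval_addSubMap_zero, -addX]
    refine mul_left_cancel₀ (mul_ne_zero h16 (pow_ne_zero 2 hx')) ?_
    have hb := W.b_relation
    -- The product of the two chord formulas is even in both u and v, so the curve equations for u²
    -- and v² eliminate them; the relation between the b's accounts for b₈.
    trans (4 * (x₁ - x₂) ^ 2 * X₁) * (4 * (x₁ - x₂) ^ 2 * X₂)
    · rw [hX₁, hX₂]
      linear_combination (-4) * (x₁ - x₂) ^ 2 * hb
        - (p₁ - p₂) * (u ^ 2 - v ^ 2 + (4 * x₁ ^ 3 + W.b₂ * x₁ ^ 2 + 2 * W.b₄ * x₁ + W.b₆)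
          - (4 * x₂ ^ 3 + W.b₂ * x₂ ^ 2 + 2 * W.b₄ * x₂ + W.b₆))
        + 2 * (x₁ - x₂) ^ 2 * (W.b₂ + 4 * x₁ + 4 * x₂) * (p₁ + p₂)
    · ring
  · simp [eval_addSubMap_one, -addX]
    refine mul_left_cancel₀ h4 ?_
    linear_combination -hX₁ - hX₂ - 2 * p₁ - 2 * p₂
  · simp [eval_addSubMap_two]; ring

end SymmetricSquare

/-! ### Two-torsion and halving over an algebraically closed field -/

section AlgClosed

variable {K : Type*} [Field K] {W : WeierstrassCurve K}

lemma nonsingular_of_sq_psi [W.IsElliptic] (h2 : (2 : K) ≠ 0) {x ψ : K}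
    (h : ψ ^ 2 = 4 * x ^ 3 + W.b₂ * x ^ 2 + 2 * W.b₄ * x + W.b₆) :
    W.toAffine.Nonsingular x ((ψ - W.a₁ * x - W.a₃) / 2) := by
  rw [← equation_iff_nonsingular, equation_iff]
  have h4 : (4 : K) ≠ 0 := by
    rw [show (4 : K) = 2 * 2 by norm_num]; exact mul_ne_zero h2 h2
  refine mul_left_cancel₀ h4 ?_
  simp only [b₂, b₄, b₆] at h
  field_simp
  linear_combination h

lemma exists_nonsingular [W.IsElliptic] [IsAlgClosed K] (h2 : (2 : K) ≠ 0) (x : K) :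
    ∃ y, W.toAffine.Nonsingular x y := by
  obtain ⟨ψ, hψ⟩ := IsAlgClosed.exists_pow_nat_eq
    (4 * x ^ 3 + W.b₂ * x ^ 2 + 2 * W.b₄ * x + W.b₆) two_pos
  exact ⟨_, nonsingular_of_sq_psi h2 hψ⟩

/-- The two-torsion polynomial has no double root. -/
lemma twoTorsion_derivative_ne_zero [W.IsElliptic] (h2 : (2 : K) ≠ 0) {x : K}
    (h : 4 * x ^ 3 + W.b₂ * x ^ 2 + 2 * W.b₄ * x + W.b₆ = 0) :
    12 * x ^ 2 + 2 * W.b₂ * x + 2 * W.b₄ ≠ 0 := by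
  intro h'
  have h4 : (4 : K) ≠ 0 := by
    rw [show (4 : K) = 2 * 2 by norm_num]; exact mul_ne_zero h2 h2
  have h'' : 6 * x ^ 2 + W.b₂ * x + W.b₄ = 0 := mul_left_cancel₀ h2 (by linear_combination h')
  -- A double root x would make (x², 2x, 1) a common zero of the three forms, which an elliptic
  -- curve does not allow.
  have hv : (![x * x, x + x, 1] : Fin 3 → K) ≠ 0 := fun h ↦ one_ne_zero (congrFun h 2)
  refine W.addSubMap_ne_zero hv ?_
  ext i
  fin_cases i
  · simp [eval_addSubMap_zero]
    refine mul_left_cancel₀ h4 ?_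
    linear_combination (6 * x ^ 2 + W.b₂ * x + W.b₄) * h'' - (8 * x + W.b₂) * h - W.b_relation
  · simp [eval_addSubMap_one]; linear_combination h
  · simp [eval_addSubMap_two]; ring

variable [DecidableEq K]

lemma add_self_eq_zero_iff {x y : K} (h : W.toAffine.Nonsingular x y) :
    Point.some x y h + Point.some x y h = 0 ↔ 2 * y + W.a₁ * x + W.a₃ = 0 := by
  rw [← two_torsion_iff]
  refine ⟨fun h0 ↦ ?_, Point.add_self_of_Y_eq⟩
  by_contra hy
  rw [Point.add_self_of_Y_ne hy] at h0
  exact Point.some_ne_zero _ h0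

/-- The condition x(2Q) = x₀ is a monic quartic equation in x(Q), obtained from the duplication
forms; the sign of Q is adjusted at the end. -/
lemma exists_add_self_eq [W.IsElliptic] [IsAlgClosed K] (h2 : (2 : K) ≠ 0) (P : W.toAffine.Point) :
    ∃ Q, Q + Q = P := by
  rcases P with _ | ⟨x₀, y₀, h₀⟩
  · exact ⟨0, add_zero 0⟩
  obtain ⟨x, hx⟩ := IsAlgClosed.exists_root (X ^ 4 + (- C (4 * x₀) * X ^ 3 +
      C (-W.b₄ - x₀ * W.b₂) * X ^ 2 + C (-2 * W.b₆ - 2 * x₀ * W.b₄) * X + C (-W.b₈ - x₀ * W.b₆)))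
    (by
      rw [degree_add_eq_left_of_degree_lt] <;> rw [degree_X_pow]
      · norm_num
      · refine lt_of_le_of_lt (b := 3) ?_ (by norm_num)
        compute_degree)
  simp [IsRoot] at hx
  obtain ⟨y, h⟩ := exists_nonsingular (W := W) h2 x
  obtain ⟨c, hc, hi⟩ := sym2x_add_sub_self (.some x y h)
  have hi0 := hi 0
  have hi1 := hi 1
  rw [eval_addSubMap_zero] at hi0
  rw [eval_addSubMap_one] at hi1
  rcases hP : Point.some x y h + Point.some x y h with _ | ⟨x', y', h'⟩
  · rw [hP, ← Point.zero_def] at hi0 hi1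
    simp at hi0 hi1
    exact absurd (by linear_combination hx - hi0 + x₀ * hi1) hc
  · rw [hP] at hi0 hi1
    simp at hi0 hi1
    have : x' = x₀ := mul_left_cancel₀ hc (by linear_combination hx - hi0 + x₀ * hi1)
    rcases Point.X_eq_iff.1 this with e | e
    · exact ⟨_, hP.trans e⟩
    · refine ⟨-Point.some x y h, ?_⟩
      rw [← neg_add, hP, e, neg_neg]

lemma card_two_torsion [W.IsElliptic] [IsAlgClosed K] (h2 : (2 : K) ≠ 0) :
    Set.ncard {P : W.toAffine.Point | P + P = 0} = 4 := by
  have hd := W.twoTorsionPolynomial_discr_ne_zero_of_isElliptic h2.isUnit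
  have h4 : (4 : K) ≠ 0 := by
    rw [show (4 : K) = 2 * 2 by norm_num]; exact mul_ne_zero h2 h2
  have h4' : W.twoTorsionPolynomial.a ≠ 0 := h4
  obtain ⟨x, y, z, h3⟩ := (Cubic.splits_iff_roots_eq_three (φ := RingHom.id K) h4').1
    (IsAlgClosed.splits _)
  obtain ⟨hxy, hxz, hyz⟩ := (Cubic.discr_ne_zero_iff_roots_ne h4' h3).1 hd
  have key (t : K) : 4 * t ^ 3 + W.b₂ * t ^ 2 + 2 * W.b₄ * t + W.b₆ = 0 ↔ t = x ∨ t = y ∨ t = z := by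
    have : W.twoTorsionPolynomial.toPoly ≠ 0 := Cubic.ne_zero_of_a_ne_zero h4'
    have hm : t ∈ (Cubic.map (RingHom.id K) W.twoTorsionPolynomial).roots ↔
        t ∈ ({x, y, z} : Multiset K) := by rw [h3]
    rw [Cubic.map_roots, Polynomial.map_id, mem_roots this] at hm
    simpa [IsRoot, Cubic.toPoly, twoTorsionPolynomial] using hm
  have hns (t : K) (ht : 4 * t ^ 3 + W.b₂ * t ^ 2 + 2 * W.b₄ * t + W.b₆ = 0) :
      W.toAffine.Nonsingular t ((0 - W.a₁ * t - W.a₃) / 2) :=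
    nonsingular_of_sq_psi h2 (by rw [ht]; ring)
  have hx := hns x ((key x).2 (by simp))
  have hy := hns y ((key y).2 (by simp))
  have hz := hns z ((key z).2 (by simp))
  have : {P : W.toAffine.Point | P + P = 0} = 
      {0, Point.some _ _ hx, Point.some _ _ hy, Point.some _ _ hz} := by
    ext P
    simp only [Set.mem_ofPred_eq, Set.mem_insert_iff, Set.mem_singleton_iff]
    rcases P with _ | ⟨x', y', h'⟩
    · simp [← Point.zero_def]
    rw [add_self_eq_zero_iff]
    simp only [Point.some.injEq, Point.some_ne_zero, false_or]
    constructor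
    · intro h
      have := sq_psi h'.1
      rw [h, zero_pow two_ne_zero, eq_comm, key] at this
      have hy' : y' = (0 - W.a₁ * x' - W.a₃) / 2 := by
        field_simp; linear_combination h
      rcases this with rfl | rfl | rfl <;> simp [hy']
    · rintro (⟨rfl, rfl⟩ | ⟨rfl, rfl⟩ | ⟨rfl, rfl⟩) <;> field_simp <;> ring
  rw [this, Set.ncard_insert_of_notMem, Set.ncard_insert_of_notMem, Set.ncard_pair]
  · simpa using fun h ↦ absurd h hyz
  · simp [hxy, hxz]
  · simp [(Point.some_ne_zero _).symm]

end AlgClosed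

/-! ### Maximal degrees of tuples of polynomials -/

section TopDegree

variable {K : Type*} [Field K]

/-- `N` is the maximum of the degrees of the members of `f`. -/
def IsTopDegree {ι : Type*} (f : ι → K[X]) (N : ℕ) : Prop :=
  (∀ i, (f i).natDegree ≤ N) ∧ ∃ i, (f i).coeff N ≠ 0

lemma IsTopDegree.unique {ι : Type*} {f : ι → K[X]} {M N : ℕ} (hM : IsTopDegree f M)
    (hN : IsTopDegree f N) : M = N := by
  obtain ⟨hM, i, hi⟩ := hM
  obtain ⟨hN, j, hj⟩ := hN
  exact le_antisymm ((le_natDegree_of_ne_zero hi).trans (hN i))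
    ((le_natDegree_of_ne_zero hj).trans (hM j))

lemma isTopDegree_max {A B : K[X]} (h : IsCoprime A B) :
    IsTopDegree ![A, B] (max A.natDegree B.natDegree) := by
  refine ⟨fun i ↦ by fin_cases i <;> simp, ?_⟩
  by_contra! h0
  have hA : A.coeff (max A.natDegree B.natDegree) = 0 := h0 0
  have hB : B.coeff (max A.natDegree B.natDegree) = 0 := h0 1
  rcases le_total A.natDegree B.natDegree with hd | hd
  · rw [max_eq_right hd] at hA hB
    obtain rfl : B = 0 := leadingCoeff_eq_zero.1 hB
    rw [natDegree_zero, Nat.le_zero] at hd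
    rw [natDegree_zero, ← hd] at hA
    obtain rfl : A = 0 := leadingCoeff_eq_zero.1 hA
    exact not_isCoprime_zero_zero h
  · rw [max_eq_left hd] at hA hB
    obtain rfl : A = 0 := leadingCoeff_eq_zero.1 hA
    rw [natDegree_zero, Nat.le_zero] at hd
    rw [natDegree_zero, ← hd] at hB
    obtain rfl : B = 0 := leadingCoeff_eq_zero.1 hB
    exact not_isCoprime_zero_zero h

/-- The top coefficients multiply as two binary linear forms do, and a product of nonzero linear
forms is nonzero. -/
lemma IsTopDegree.sym2 {A B C D : K[X]} {M N : ℕ} (hM : IsTopDegree ![A, B] M)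
    (hN : IsTopDegree ![C, D] N) : IsTopDegree ![A * C, A * D + B * C, B * D] (M + N) := by
  obtain ⟨hM, i, hi⟩ := hM
  obtain ⟨hN, j, hj⟩ := hN
  have hA : A.natDegree ≤ M := hM 0
  have hB : B.natDegree ≤ M := hM 1
  have hC : C.natDegree ≤ N := hN 0
  have hD : D.natDegree ≤ N := hN 1
  refine ⟨fun i ↦ ?_, ?_⟩
  · fin_cases i
    · exact natDegree_mul_le_of_le hA hC
    · exact natDegree_add_le_of_degree_le (natDegree_mul_le_of_le hA hD)
        (natDegree_mul_le_of_le hB hC)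
    · exact natDegree_mul_le_of_le hB hD
  · by_contra! h
    have h0 := h 0
    have h1 := h 1
    have h2 := h 2
    simp only [Matrix.cons_val_zero, Matrix.cons_val_one, Matrix.cons_val, coeff_add,
      coeff_mul_add_eq_of_natDegree_le hA hC, coeff_mul_add_eq_of_natDegree_le hA hD,
      coeff_mul_add_eq_of_natDegree_le hB hC, coeff_mul_add_eq_of_natDegree_le hB hD] at h0 h1 h2
    have hab : A.coeff M ≠ 0 ∨ B.coeff M ≠ 0 := by
      fin_cases i
      · exact .inl hi
      · exact .inr hi
    have hcd : C.coeff N ≠ 0 ∨ D.coeff N ≠ 0 := by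
      fin_cases j
      · exact .inl hj
      · exact .inr hj
    grind

end TopDegree

/-! ### The addition forms over polynomials -/

section AddSub

variable {R : Type*} [CommRing R]

/-- The forms `WeierstrassCurve.addSubMap` as functions on coordinate vectors. -/
def addSubVec (W : WeierstrassCurve R) (v : Fin 3 → R) : Fin 3 → R :=
  ![v 0 * v 0 - W.b₄ * (v 0 * v 2) - W.b₆ * (v 1 * v 2) - W.b₈ * (v 2 * v 2),
    2 * (v 1 * v 0) + W.b₂ * (v 0 * v 2) + W.b₄ * (v 1 * v 2) + W.b₆ * (v 2 * v 2),
    v 1 * v 1 - 4 * (v 0 * v 2)]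

variable {K : Type*} [Field K] (W : WeierstrassCurve K)

lemma addSubVec_eq (v : Fin 3 → K) (i : Fin 3) : addSubVec W v i = (W.addSubMap i).eval v := by
  fin_cases i <;>
    simp [eval_addSubMap_zero, eval_addSubMap_one, eval_addSubMap_two, addSubVec] <;> ring

lemma addSubVec_ne_zero [W.IsElliptic] {v : Fin 3 → K} (hv : v ≠ 0) : addSubVec W v ≠ 0 := by
  rw [show addSubVec W v = _ from funext (addSubVec_eq W v)]
  exact W.addSubMap_ne_zero hv

lemma addSubVec_smul (c : K) (v : Fin 3 → K) :
    addSubVec W (c • v) = c ^ 2 • addSubVec W v := by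
  ext i; fin_cases i <;> simp [addSubVec] <;> ring

lemma eval_addSubVec (v : Fin 3 → K[X]) (x : K) (i : Fin 3) :
    (addSubVec (W.map C) v i).eval x = addSubVec W (fun j ↦ (v j).eval x) i := by
  fin_cases i <;> simp [addSubVec]

/-- The coefficients in degree 2N are the forms evaluated at the coefficients in degree N. Having no
nontrivial common zero, the forms do not all vanish there, so the degree doubles exactly. -/
lemma IsTopDegree.addSubVec [W.IsElliptic] {v : Fin 3 → K[X]} {N : ℕ} (h : IsTopDegree v N) :
    IsTopDegree (addSubVec (W.map C) v) (N + N) := by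
  obtain ⟨h, j, hj⟩ := h
  have hd (i j : Fin 3) : (v i * v j).natDegree ≤ N + N := natDegree_mul_le_of_le (h i) (h j)
  have hc (i j : Fin 3) : (v i * v j).coeff (N + N) = (v i).coeff N * (v j).coeff N :=
    coeff_mul_add_eq_of_natDegree_le (h i) (h j)
  have hC (c : K) (i j : Fin 3) : (C c * (v i * v j)).natDegree ≤ N + N :=
    (natDegree_C_mul_le _ _).trans (hd i j)
  have h2 (i j : Fin 3) : (2 * (v i * v j)).natDegree ≤ N + N := hC 2 i j
  have h4 (i j : Fin 3) : (4 * (v i * v j)).natDegree ≤ N + N := hC 4 i j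
  have c2 (p : K[X]) : (2 * p).coeff (N + N) = 2 * p.coeff (N + N) := coeff_C_mul p
  have c4 (p : K[X]) : (4 * p).coeff (N + N) = 4 * p.coeff (N + N) := coeff_C_mul p
  have hco : (fun i ↦ (EllipticIsogeny.addSubVec (W.map C) v i).coeff (N + N)) =
      EllipticIsogeny.addSubVec W (fun i ↦ (v i).coeff N) := by
    ext i
    fin_cases i <;> simp [EllipticIsogeny.addSubVec, hc, c2, c4]
  constructor
  · intro i
    fin_cases i
    · simp only [EllipticIsogeny.addSubVec, map_b₄, map_b₆, map_b₈]
      exact natDegree_sub_le_of_le (natDegree_sub_le_of_le (natDegree_sub_le_of_le (hd _ _)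
        (hC _ _ _)) (hC _ _ _)) (hC _ _ _) |>.trans (by simp)
    · simp only [EllipticIsogeny.addSubVec, map_b₄, map_b₆, map_b₂]
      exact natDegree_add_le_of_le (natDegree_add_le_of_le (natDegree_add_le_of_le (h2 _ _)
        (hC _ _ _)) (hC _ _ _)) (hC _ _ _) |>.trans (by simp)
    · simp only [EllipticIsogeny.addSubVec]
      exact natDegree_sub_le_of_le (hd _ _) (h4 _ _) |>.trans (by simp)
  · have := addSubVec_ne_zero W (v := fun i ↦ (v i).coeff N) (fun h0 ↦ hj (congrFun h0 j))
    rw [← hco] at this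
    by_contra! h'
    exact this (funext h')

end AddSub

/-! ### Endomorphisms on x-coordinates and the parallelogram law -/

section Represents

variable {K : Type*} [Field K] [DecidableEq K] {W : WeierstrassCurve K}

/-- The coprime polynomials `A`, `B` satisfy `x(g(P)) = A(x(P)) / B(x(P))`, as points of the
projective line, for all affine points `P` with `x(P)` outside `S`. -/
structure XRepresents (S : Set K) (g : W.toAffine.Point →+ W.toAffine.Point) (A B : K[X]) :
    Prop where
  isCoprime : IsCoprime A B
  eval_eq : ∀ (x y : K) (h : W.toAffine.Nonsingular x y), x ∉ S →
    A.eval x * (g (.some x y h)).xRep 1 = B.eval x * (g (.some x y h)).xRep 0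

omit [DecidableEq K] in
lemma exists_ne_zero_of_mul_eq_mul {a b p q : K} (hab : a ≠ 0 ∨ b ≠ 0) (hpq : p ≠ 0 ∨ q ≠ 0)
    (h : a * q = b * p) : ∃ c, c ≠ 0 ∧ a = c * p ∧ b = c * q := by
  rcases hpq with hp | hq
  · refine ⟨a / p, fun h0 ↦ ?_, by field_simp, by field_simp; exact h.symm⟩
    have ha : a = 0 := by simpa [hp] using h0
    rw [ha, zero_mul, eq_comm, mul_eq_zero] at h
    simp_all
  · refine ⟨b / q, fun h0 ↦ ?_, by field_simp; exact h, by field_simp⟩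
    have hb : b = 0 := by simpa [hq] using h0
    rw [hb, zero_mul, mul_eq_zero] at h
    simp_all

omit [DecidableEq K] in
lemma xRep_ne_zero_or (P : W.toAffine.Point) : P.xRep 0 ≠ 0 ∨ P.xRep 1 ≠ 0 := by
  by_contra! h
  exact P.xRep_ne_zero (by ext i; fin_cases i; exacts [h.1, h.2])

lemma XRepresents.exists_eval_eq {S : Set K} {g : W.toAffine.Point →+ W.toAffine.Point} {A B : K[X]}
    (h : XRepresents S g A B) {x y : K} (hxy : W.toAffine.Nonsingular x y) (hx : x ∉ S) :
    ∃ c, c ≠ 0 ∧ A.eval x = c * (g (.some x y hxy)).xRep 0 ∧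
      B.eval x = c * (g (.some x y hxy)).xRep 1 :=
  exists_ne_zero_of_mul_eq_mul (by simpa using aeval_ne_zero_of_isCoprime h.isCoprime x)
    (xRep_ne_zero_or _) (h.eval_eq x y hxy hx)

omit [DecidableEq K] in
/-- A binary quadratic form over `K[X]` with a primitive zero factors. -/
lemma exists_factor_of_isCoprime {F₀ F₁ F₂ A B : K[X]} (hAB : IsCoprime A B)
    (h : F₀ * B ^ 2 - F₁ * (A * B) + F₂ * A ^ 2 = 0) :
    ∃ U V, F₀ = U * A ∧ F₁ = U * B + V * A ∧ F₂ = V * B := by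
  have hA : A ∣ F₀ := (hAB.pow_right (n := 2)).dvd_of_dvd_mul_right
    ⟨F₁ * B - F₂ * A, by linear_combination h⟩
  have hB : B ∣ F₂ := (hAB.symm.pow_right (n := 2)).dvd_of_dvd_mul_right
    ⟨F₁ * A - F₀ * B, by linear_combination h⟩
  obtain ⟨U, rfl⟩ := hA
  obtain ⟨V, rfl⟩ := hB
  by_cases hA0 : A = 0
  · subst hA0
    obtain ⟨b, hb⟩ := isUnit_iff_exists_inv.1 (isCoprime_zero_left.1 hAB)
    exact ⟨F₁ * b, V, by ring, by linear_combination (-F₁) * hb, by ring⟩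
  by_cases hB0 : B = 0
  · subst hB0
    obtain ⟨a, ha⟩ := isUnit_iff_exists_inv.1 (isCoprime_zero_right.1 hAB)
    exact ⟨U, F₁ * a, by ring, by linear_combination (-F₁) * ha, by ring⟩
  refine ⟨U, V, by ring, ?_, by ring⟩
  refine mul_left_cancel₀ (mul_ne_zero hA0 hB0) ?_
  linear_combination -h

/-- The parallelogram law for degrees. -/
theorem XRepresents.add [W.IsElliptic] [IsAlgClosed K] (h2 : (2 : K) ≠ 0) {S : Set K}
    (hS : S.Finite) {g h : W.toAffine.Point →+ W.toAffine.Point} {A B A' B' C D : K[X]}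
    (hg : XRepresents S g A B) (hh : XRepresents S h A' B') (hgh : XRepresents S (g - h) C D) :
    ∃ U V, XRepresents S (g + h) U V ∧
      max U.natDegree V.natDegree + max C.natDegree D.natDegree =
        2 * max A.natDegree B.natDegree + 2 * max A'.natDegree B'.natDegree := by
  set v : Fin 3 → K[X] := ![A * A', A * B' + B * A', B * B'] with hv
  set F := addSubVec (W.map Polynomial.C) v with hF
  have hFx {x y : K} (hxy : W.toAffine.Nonsingular x y) (hx : x ∉ S) : ∃ c, c ≠ 0 ∧
      ∀ i, (F i).eval x = c * ((g + h) (.some x y hxy)).sym2x ((g - h) (.some x y hxy)) i := by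
    obtain ⟨c, hc, hA, hB⟩ := hg.exists_eval_eq hxy hx
    obtain ⟨c', hc', hA', hB'⟩ := hh.exists_eval_eq hxy hx
    obtain ⟨e, he, hi⟩ := sym2x_add_sub h2 (g (.some x y hxy)) (h (.some x y hxy))
    refine ⟨(c * c') ^ 2 * e, by positivity, fun i ↦ ?_⟩
    rw [hF, eval_addSubVec]
    have : (fun j ↦ (v j).eval x) =
        (c * c') • (g (.some x y hxy)).sym2x (h (.some x y hxy)) := by
      ext j
      fin_cases j <;> simp [hv, hA, hB, hA', hB', Point.sym2x] <;> ring
    rw [this, addSubVec_smul, Pi.smul_apply, addSubVec_eq, hi, smul_eq_mul]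
    simp [mul_assoc]
  -- The entries of F are the symmetric functions of x(g+h) and x(g-h), so (C : D), which represents
  -- x(g-h), is a root of the associated binary quadratic form. The identity holds at all x outside
  -- the finite set S, hence as polynomials. Splitting off this root leaves (U : V) for x(g+h).
  have hzero : F 0 * D ^ 2 - F 1 * (C * D) + F 2 * C ^ 2 = 0 := by
    refine eq_zero_of_infinite_isRoot _ (hS.infinite_compl.mono fun x hx ↦ ?_)
    obtain ⟨y, hxy⟩ := exists_nonsingular (W := W) h2 x
    obtain ⟨c, hc, hi⟩ := hFx hxy hx
    obtain ⟨e, he, hC, hD⟩ := hgh.exists_eval_eq hxy hx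
    simp only [IsRoot, Set.mem_ofPred_eq, eval_add, eval_sub, eval_mul, eval_pow, hi, hC, hD,
      Point.sym2x, Matrix.cons_val_zero, Matrix.cons_val_one, Matrix.cons_val]
    ring
  obtain ⟨U, V, h0, h1, h2⟩ := exists_factor_of_isCoprime hgh.isCoprime hzero
  -- A common root of U and V would be a zero of F, hence of v, contrary to the coprimality of both
  -- input pairs. Thus nothing cancels and the degrees below are exact.
  have hcop : IsCoprime U V := by
    refine (isCoprime_iff_aeval_ne_zero_of_isAlgClosed K K U V).2 fun x ↦ ?_
    simp only [coe_aeval_eq_eval]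
    by_contra! hx
    have hFx : addSubVec W (fun j ↦ (v j).eval x) = 0 := by
      ext i
      rw [← eval_addSubVec, ← hF]
      fin_cases i
      · simp [h0, hx]
      · simp [h1, hx]
      · simp [h2, hx]
    have hvx := not_imp_not.1 (addSubVec_ne_zero W) hFx
    have v0 := congrFun hvx 0
    have v1 := congrFun hvx 1
    have v2 := congrFun hvx 2
    simp [hv] at v0 v1 v2
    have hA : A.eval x ≠ 0 ∨ B.eval x ≠ 0 := by
      simpa using aeval_ne_zero_of_isCoprime hg.isCoprime x
    have hA' : A'.eval x ≠ 0 ∨ B'.eval x ≠ 0 := by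
      simpa using aeval_ne_zero_of_isCoprime hh.isCoprime x
    grind
  refine ⟨U, V, ⟨hcop, fun x y hxy hx ↦ ?_⟩, ?_⟩
  · obtain ⟨c, hc, hi⟩ := hFx hxy hx
    obtain ⟨e, he, hC, hD⟩ := hgh.exists_eval_eq hxy hx
    have hi0 := hi 0
    have hi1 := hi 1
    have hi2 := hi 2
    rw [h0] at hi0
    rw [h1] at hi1
    rw [h2] at hi2
    simp only [eval_add, eval_mul, hC, hD, Point.sym2x, Matrix.cons_val_zero, Matrix.cons_val_one,
      Matrix.cons_val] at hi0 hi1 hi2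
    have hq := xRep_ne_zero_or ((g - h) (.some x y hxy))
    generalize ((g - h) (.some x y hxy)).xRep 0 = q₀ at *
    generalize ((g - h) (.some x y hxy)).xRep 1 = q₁ at *
    generalize ((g + h) (.some x y hxy)).xRep 0 = p₀ at *
    generalize ((g + h) (.some x y hxy)).xRep 1 = p₁ at *
    generalize eval x U = u at *
    generalize eval x V = v at *
    refine mul_left_cancel₀ he ?_
    rcases hq with hq | hq
    · have e0 : e * u = c * p₀ := mul_right_cancel₀ hq (by linear_combination hi0)
      have e1 : e * v = c * p₁ := mul_right_cancel₀ hq (by linear_combination hi1 - q₁ * e0)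
      linear_combination p₁ * e0 - p₀ * e1
    · have e1 : e * v = c * p₁ := mul_right_cancel₀ hq (by linear_combination hi2)
      have e0 : e * u = c * p₀ := mul_right_cancel₀ hq (by linear_combination hi1 - q₀ * e1)
      linear_combination p₁ * e0 - p₀ * e1
  -- The top degree of F is computed twice: as a product of (U, V) with (C, D), and as a quadratic
  -- form in v.
  · have t1 := (isTopDegree_max hcop).sym2 (isTopDegree_max hgh.isCoprime)
    have t2 := ((isTopDegree_max hg.isCoprime).sym2 (isTopDegree_max hh.isCoprime)).addSubVec W
    have : ![U * C, U * D + V * C, V * D] = F := by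
      ext1 i; fin_cases i
      exacts [h0.symm, h1.symm, h2.symm]
    rw [this] at t1
    have := t1.unique t2
    omega

end Represents

/-! ### Counting rational points by x-coordinate -/

section Count

variable {F : Type*} [Field F] [Fintype F]

lemma X_pow_card_sub_X_eq_prod : (X ^ Fintype.card F - X : F[X]) = ∏ r : F, (X - C r) := by
  have hd := FiniteField.X_pow_card_sub_X_natDegree_eq F (Fintype.one_lt_card (α := F))
  have hm : (X ^ Fintype.card F - X : F[X]).Monic := by
    apply monic_X_pow_sub
    rw [degree_X]
    exact_mod_cast Fintype.one_lt_card (α := F)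
  have := prod_multiset_X_sub_C_of_monic_of_roots_card_eq hm (by
    rw [FiniteField.roots_X_pow_card_sub_X, hd]; rfl)
  rw [FiniteField.roots_X_pow_card_sub_X] at this
  exact this.symm

lemma mem_range_algebraMap_iff {K : Type*} [Field K] [Algebra F K] {x : K} :
    x ∈ Set.range (algebraMap F K) ↔ x ^ Fintype.card F = x := by
  have h := congrArg (aeval x) (X_pow_card_sub_X_eq_prod (F := F))
  simp only [map_sub, map_pow, aeval_X, map_prod, aeval_C] at h
  rw [← sub_eq_zero (a := x ^ _), h, Finset.prod_eq_zero_iff]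
  simp only [Finset.mem_univ, true_and, sub_eq_zero, Set.mem_range, eq_comm (a := x)]

variable (W : WeierstrassCurve F)

open scoped Classical in
/-- The number of affine points with a given `x`-coordinate. -/
noncomputable def fiberCard (r : F) : ℕ :=
  (Finset.univ.filter fun y : F ↦ W.toAffine.Equation r y).card

/-- The polynomial `4x³ + b₂x² + 2b₄x + b₆`. -/
noncomputable def psiSq {R : Type*} [CommRing R] (W : WeierstrassCurve R) : R[X] :=
  C 4 * X ^ 3 + C W.b₂ * X ^ 2 + C (2 * W.b₄) * X + C W.b₆

lemma card_point [W.IsElliptic] : Nat.card W.toAffine.Point = ∑ r, fiberCard W r + 1 := by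
  classical
  rw [Nat.card_congr (pointEquiv W.toAffine), WithZero, Nat.card_eq_fintype_card,
    Fintype.card_option, Fintype.card_subtype, Finset.card_filter, ← Finset.univ_product_univ,
    Finset.sum_product]
  simp only [fiberCard, Finset.card_filter]

/-- The substitution ψ = 2y + a₁r + a₃ identifies the fibre with the square roots of `psiSq` at r,
and Euler's criterion gives their number. As q is odd, `Fintype.card F / 2` is (q - 1) / 2. -/
lemma fiberCard_cases (hF : ringChar F ≠ 2) (r : F) :
    (fiberCard W r = 2 ∧ (psiSq W).eval r ≠ 0 ∧ (psiSq W).eval r ^ (Fintype.card F / 2) = 1) ∨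
    (fiberCard W r = 1 ∧ (psiSq W).eval r = 0) ∨
    (fiberCard W r = 0 ∧ (psiSq W).eval r ^ (Fintype.card F / 2) = -1) := by
  classical
  have h2 : (2 : F) ≠ 0 := Ring.two_ne_zero hF
  have h4 : (4 : F) ≠ 0 := by
    rw [show (4 : F) = 2 * 2 by norm_num]; exact mul_ne_zero h2 h2
  have hcard : (fiberCard W r : ℤ) = quadraticChar F ((psiSq W).eval r) + 1 := by
    rw [← quadraticChar_card_sqrts hF, fiberCard, Nat.cast_inj]
    refine Finset.card_bij' (fun y _ ↦ 2 * y + W.a₁ * r + W.a₃)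
      (fun ψ _ ↦ (ψ - W.a₁ * r - W.a₃) / 2) ?_ ?_ ?_ ?_
    · intro y hy
      simp only [Finset.mem_filter, Finset.mem_univ, true_and] at hy
      simpa [psiSq] using sq_psi hy
    · intro ψ hψ
      rw [Set.mem_toFinset, Set.mem_ofPred_eq] at hψ
      simp [psiSq, b₂, b₄, b₆] at hψ
      simp only [Finset.mem_filter, Finset.mem_univ, true_and, equation_iff]
      refine mul_left_cancel₀ h4 ?_
      field_simp
      linear_combination hψ
    · intro y _; field_simp; ring
    · intro y _; field_simp; ring
  by_cases h0 : (psiSq W).eval r = 0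
  · rw [h0, quadraticChar_zero] at hcard
    exact .inr (.inl ⟨by omega, h0⟩)
  have hpow := quadraticChar_eq_pow_of_char_ne_two' hF ((psiSq W).eval r)
  rcases quadraticChar_dichotomy h0 with h | h
  · rw [h] at hcard hpow
    exact .inl ⟨by omega, h0, by rw [← hpow]; simp⟩
  · rw [h] at hcard hpow
    exact .inr (.inr ⟨by omega, by rw [← hpow]; simp⟩)

end Count

/-! ### The degree of Frobenius minus one -/

section FrobeniusSubOne

variable {F : Type*} [Field F] [Fintype F] (W : WeierstrassCurve F)

/-- Numerator of the `x`-coordinate of the Frobenius minus the identity, before reduction. -/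
noncomputable def frobSubNum : F[X] :=
  psiSq W * (psiSq W ^ (Fintype.card F / 2) + 1) ^ 2 -
    (X ^ Fintype.card F - X) ^ 2 * (C W.b₂ + 4 * X ^ Fintype.card F + 4 * X)

omit [Fintype F] in
lemma natDegree_psiSq_le : (psiSq W).natDegree ≤ 3 := by
  rw [psiSq]; compute_degree

/-- The terms 4X^(3q) and b₂X^(2q) of `psiSq W ^ q` cancel against the second product, which leaves
8 - 4 = 4 as the coefficient of X^(2q+1). The mixed term has degree at most 3(q + 1) / 2 ≤ 2q
because q ≥ 3. -/
lemma natDegree_frobSubNum (hF : ringChar F ≠ 2) :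
    (frobSubNum W).natDegree = 2 * Fintype.card F + 1 := by
  have h2 : (2 : F) ≠ 0 := Ring.two_ne_zero hF
  have h4 : (4 : F) ≠ 0 := by
    rw [show (4 : F) = 2 * 2 by norm_num]; exact mul_ne_zero h2 h2
  have hodd := Nat.two_mul_odd_div_two (FiniteField.odd_card_of_char_ne_two hF)
  have h1 := Fintype.one_lt_card (α := F)
  have hexp : psiSq W ^ Fintype.card F = C 4 * X ^ (3 * Fintype.card F) +
      C W.b₂ * X ^ (2 * Fintype.card F) + C (2 * W.b₄) * X ^ (Fintype.card F) + C W.b₆ := by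
    rw [← FiniteField.expand_card, psiSq]
    simp only [map_add, map_mul, map_pow, expand_X, expand_C, ← pow_mul, mul_comm (Fintype.card F)]
  set q := Fintype.card F
  set h := q / 2
  have hR : frobSubNum W = C 4 * X ^ (2 * q + 1) +
      (C (2 * W.b₄) * X ^ q + C W.b₆ + C 2 * psiSq W ^ (h + 1) + psiSq W + C (2 * W.b₂) * X ^ (q + 1)
        - C W.b₂ * X ^ 2 + C 4 * X ^ (q + 2) - C 4 * X ^ 3) := by
    have : psiSq W * (psiSq W ^ h + 1) ^ 2 = psiSq W ^ q + C 2 * psiSq W ^ (h + 1) + psiSq W := by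
      rw [show q = 2 * h + 1 by omega, show (C 2 : F[X]) = 2 from rfl]
      ring
    rw [frobSubNum, this, hexp, show (C 4 : F[X]) = 4 from rfl, C_mul, C_mul,
      show (C 2 : F[X]) = 2 from rfl]
    ring
  rw [hR]
  have hlt : (C (2 * W.b₄) * X ^ q + C W.b₆ + C 2 * psiSq W ^ (h + 1) + psiSq W +
      C (2 * W.b₂) * X ^ (q + 1) - C W.b₂ * X ^ 2 + C 4 * X ^ (q + 2) - C 4 * X ^ 3 :
        F[X]).natDegree ≤ 2 * q := by
    have hp : (psiSq W ^ (h + 1)).natDegree ≤ (h + 1) * 3 :=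
      natDegree_pow_le_of_le _ (natDegree_psiSq_le W)
    have hX (c : F) (n : ℕ) (hn : n ≤ 2 * q) : (C c * X ^ n).natDegree ≤ 2 * q :=
      (natDegree_C_mul_X_pow_le c n).trans hn
    have hsub {p r : F[X]} (hp : p.natDegree ≤ 2 * q) (hr : r.natDegree ≤ 2 * q) :
        (p - r).natDegree ≤ 2 * q := (natDegree_sub_le_of_le hp hr).trans (max_self _).le
    refine hsub (natDegree_add_le_of_degree_le (hsub (natDegree_add_le_of_degree_le (natDegree_add_le_of_degree_le
      (natDegree_add_le_of_degree_le (natDegree_add_le_of_degree_le ?_ ?_) ?_) ?_) ?_) ?_) ?_) ?_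
    · exact hX _ _ (by omega)
    · simp
    · exact (natDegree_C_mul_le _ _).trans (hp.trans (by omega))
    · exact (natDegree_psiSq_le W).trans (by omega)
    · exact hX _ _ (by omega)
    · exact hX _ _ (by omega)
    · exact hX _ _ (by omega)
    · exact hX _ _ (by omega)
  rw [natDegree_add_eq_left_of_natDegree_lt] <;> rw [natDegree_C_mul_X_pow _ _ h4]
  omega

/-- The common factor of numerator and denominator. -/
noncomputable def frobSubGcd : F[X] := ∏ r, (X - C r) ^ (2 - fiberCard W r)

/-- The reduced denominator. -/
noncomputable def frobSubDenom : F[X] := C 4 * ∏ r, (X - C r) ^ fiberCard W r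

lemma fiberCard_le (hF : ringChar F ≠ 2) (r : F) : fiberCard W r ≤ 2 := by
  rcases fiberCard_cases W hF r with h | h | h <;> omega

lemma frobSubGcd_mul_denom (hF : ringChar F ≠ 2) :
    frobSubGcd W * frobSubDenom W = C 4 * (X ^ Fintype.card F - X) ^ 2 := by
  rw [frobSubGcd, frobSubDenom, X_pow_card_sub_X_eq_prod, mul_left_comm, ← Finset.prod_mul_distrib,
    ← Finset.prod_pow]
  congr 1
  refine Finset.prod_congr rfl fun r _ ↦ ?_
  rw [← pow_add, Nat.sub_add_cancel (fiberCard_le W hF r)]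

lemma X_sub_C_dvd_card (r : F) : X - C r ∣ (X ^ Fintype.card F - X : F[X]) := by
  rw [dvd_iff_isRoot]; simp [FiniteField.pow_card]

/-- At r the numerator has a zero exactly as needed: none required over a fibre of size 2, one from
`psiSq` over a fibre of size 1, and a double one over an empty fibre, where `psiSq ^ ((q-1)/2) + 1`
vanishes. -/
lemma frobSubGcd_dvd (hF : ringChar F ≠ 2) : frobSubGcd W ∣ frobSubNum W := by
  refine Finset.prod_dvd_of_coprime (fun r _ s _ hrs ↦ ?_) fun r _ ↦ ?_
  · exact (isCoprime_X_sub_C_of_isUnit_sub (sub_ne_zero.2 hrs).isUnit).pow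
  · rcases fiberCard_cases W hF r with ⟨h, _⟩ | ⟨h, h0⟩ | ⟨h, h0⟩ <;> rw [h]
    · simp
    · rw [show 2 - 1 = 1 from rfl, pow_one, dvd_iff_isRoot]
      simp [frobSubNum, h0, FiniteField.pow_card]
    · refine dvd_sub (dvd_mul_of_dvd_right (pow_dvd_pow_of_dvd ?_ 2) _)
        (dvd_mul_of_dvd_left (pow_dvd_pow_of_dvd (X_sub_C_dvd_card r) 2) _)
      rw [dvd_iff_isRoot]
      simp [h0]

omit [Fintype F] in
lemma isCoprime_X_sub_C_iff {p : F[X]} {r : F} : IsCoprime p (X - C r) ↔ p.eval r ≠ 0 := by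
  rw [isCoprime_comm, (irreducible_X_sub_C r).coprime_iff_not_dvd, dvd_iff_isRoot, IsRoot]

/-- After cancellation the denominator has degree Σ `fiberCard`, the number of affine points, and
the numerator has degree 2q + 1 - Σ (2 - `fiberCard`), which is one more. The point at infinity
makes up this difference. -/
lemma exists_frobSubNum_eq [W.IsElliptic] (hF : ringChar F ≠ 2) :
    ∃ A, frobSubNum W = frobSubGcd W * A ∧ IsCoprime A (frobSubDenom W) ∧
      max A.natDegree (frobSubDenom W).natDegree = Nat.card W.toAffine.Point := by
  have h2 : (2 : F) ≠ 0 := Ring.two_ne_zero hF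
  have h4 : (4 : F) ≠ 0 := by
    rw [show (4 : F) = 2 * 2 by norm_num]; exact mul_ne_zero h2 h2
  have hodd := Nat.two_mul_odd_div_two (FiniteField.odd_card_of_char_ne_two hF)
  have hq := Fintype.one_lt_card (α := F)
  obtain ⟨A, hA⟩ := frobSubGcd_dvd W hF
  refine ⟨A, hA, ?_, ?_⟩
  · refine IsCoprime.mul_right (isCoprime_one_right.of_isCoprime_of_dvd_right
      (isUnit_C.2 h4.isUnit).dvd) (IsCoprime.prod_right fun r _ ↦ ?_)
    rcases fiberCard_cases W hF r with ⟨h, h0, h1⟩ | ⟨h, h0⟩ | ⟨h, h0⟩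
    · refine IsCoprime.pow_right (isCoprime_X_sub_C_iff.2 fun hr ↦ ?_)
      have := congrArg (eval r) hA
      rw [eval_mul, hr, mul_zero] at this
      simp [frobSubNum, h0, h1, FiniteField.pow_card] at this
      exact h2 (by linear_combination this)
    · refine IsCoprime.pow_right (isCoprime_X_sub_C_iff.2 fun hr ↦ ?_)
      -- A further zero at r would force (X - r)² to divide `psiSq W`, whose roots are simple.
      have hd : (X - C r) ^ 2 ∣ frobSubNum W := by
        rw [hA, sq]
        refine mul_dvd_mul ?_ (dvd_iff_isRoot.2 hr)
        have := Finset.dvd_prod_of_mem (fun r ↦ (X - C r) ^ (2 - fiberCard W r))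
          (Finset.mem_univ r)
        rw [frobSubGcd]
        simpa only [h, show 2 - 1 = 1 from rfl, pow_one] using this
      rw [frobSubNum, dvd_sub_left (dvd_mul_of_dvd_left
        (pow_dvd_pow_of_dvd (X_sub_C_dvd_card r) 2) _)] at hd
      have hc : IsCoprime ((X - C r) ^ 2) ((psiSq W ^ (Fintype.card F / 2) + 1) ^ 2) := by
        refine (isCoprime_X_sub_C_iff.2 ?_).symm.pow
        have : Fintype.card F / 2 ≠ 0 := by omega
        simp [h0, this]
      obtain ⟨p, hp⟩ := hc.dvd_of_dvd_mul_right hd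
      rw [sq, mul_assoc] at hp
      have hder := congrArg (fun p ↦ (derivative p).eval r) hp
      have h0' := h0
      simp [psiSq] at h0' hder
      exact twoTorsion_derivative_ne_zero h2 h0' (by linear_combination hder)
    · rw [h, pow_zero]; exact isCoprime_one_right
  · have hmon (e : F → ℕ) : (∏ r, (X - C r) ^ e r : F[X]).Monic :=
      monic_prod_of_monic _ _ fun r _ ↦ (monic_X_sub_C r).pow _
    have hdeg (e : F → ℕ) : (∏ r, (X - C r) ^ e r : F[X]).natDegree = ∑ r, e r := by
      rw [natDegree_prod_of_monic _ _ fun r _ ↦ (monic_X_sub_C r).pow _]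
      simp [natDegree_pow]
    have hD : (frobSubDenom W).natDegree = ∑ r, fiberCard W r := by
      rw [frobSubDenom, natDegree_C_mul h4, hdeg]
    have hN := natDegree_frobSubNum W hF
    have hA0 : A ≠ 0 := by rintro rfl; rw [hA, mul_zero, natDegree_zero] at hN; omega
    rw [hA, frobSubGcd, natDegree_mul (hmon _).ne_zero hA0, hdeg] at hN
    have hs : ∑ r, (2 - fiberCard W r) + ∑ r, fiberCard W r = 2 * Fintype.card F := by
      rw [← Finset.sum_add_distrib, Finset.sum_congr rfl fun r _ ↦
        Nat.sub_add_cancel (fiberCard_le W hF r)]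
      simp [mul_comm]
    rw [hD, card_point]
    omega

end FrobeniusSubOne

/-! ### Frobenius and the degree form -/

section Frobenius

variable {F : Type*} [Field F] [Fintype F] (W : WeierstrassCurve F)
  (K : Type*) [Field K] [Algebra F K] [DecidableEq K]

/-- The Frobenius endomorphism `(x, y) ↦ (x ^ q, y ^ q)` on points over an extension. -/
noncomputable def frob : (W.baseChange K).toAffine.Point →+ (W.baseChange K).toAffine.Point :=
  Point.map (W' := W.toAffine) (FiniteField.frobeniusAlgHom F K)

variable {W K}

lemma frob_some {x y : K} (h : (W.baseChange K).toAffine.Nonsingular x y) :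
    ∃ h', frob W K (.some x y h) = .some (x ^ Fintype.card F) (y ^ Fintype.card F) h' :=
  ⟨_, rfl⟩

lemma frob_injective : Function.Injective (frob W K) :=
  Point.map_injective (W' := W.toAffine) (FiniteField.frobeniusAlgHom F K)

variable (W K)

lemma xRepresents_frob (S : Set K) : XRepresents S (frob W K) (X ^ Fintype.card F) 1 where
  isCoprime := isCoprime_one_right
  eval_eq x y h _ := by
    obtain ⟨h', e⟩ := frob_some h
    simp [e]

omit [Fintype F] in
lemma xRepresents_id (S : Set K) :
    XRepresents S (AddMonoidHom.id (W.baseChange K).toAffine.Point) X 1 where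
  isCoprime := isCoprime_one_right
  eval_eq x y h _ := by simp

omit [Fintype F] in
lemma xRepresents_neg_id (S : Set K) :
    XRepresents S (-AddMonoidHom.id (W.baseChange K).toAffine.Point) X 1 where
  isCoprime := isCoprime_one_right
  eval_eq x y h _ := by simp

omit [DecidableEq K] in
variable {W K} in
lemma psi_frob {x y : K} :
    2 * y ^ Fintype.card F + (W.baseChange K).a₁ * x ^ Fintype.card F + (W.baseChange K).a₃ =
      (2 * y + (W.baseChange K).a₁ * x + (W.baseChange K).a₃) ^ Fintype.card F := by
  have h (z : K) : z ^ Fintype.card F = FiniteField.frobeniusAlgHom F K z := rfl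
  simp only [h, map_add, map_mul, WeierstrassCurve.baseChange, map_a₁, map_a₃, AlgHom.commutes,
    map_ofNat]

omit [DecidableEq K] in
variable {W K} in
lemma aeval_frobSubNum (hF : ringChar F ≠ 2) {x y : K}
    (h : (W.baseChange K).toAffine.Nonsingular x y) :
    aeval x (frobSubNum W) =
      ((2 * y + (W.baseChange K).a₁ * x + (W.baseChange K).a₃) ^ Fintype.card F +
        (2 * y + (W.baseChange K).a₁ * x + (W.baseChange K).a₃)) ^ 2 -
      (x ^ Fintype.card F - x) ^ 2 *
        ((W.baseChange K).b₂ + 4 * x ^ Fintype.card F + 4 * x) := by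
  have hodd := Nat.two_mul_odd_div_two (FiniteField.odd_card_of_char_ne_two hF)
  have hq := Fintype.one_lt_card (α := F)
  have hpsi := sq_psi h.1
  have hx : aeval x (psiSq W) =
      (2 * y + (W.baseChange K).a₁ * x + (W.baseChange K).a₃) ^ 2 := by
    rw [hpsi]
    simp only [psiSq, map_add, map_mul, map_pow, aeval_X, aeval_C, WeierstrassCurve.baseChange,
      map_b₂, map_b₄, map_b₆, map_ofNat]
  have hb : algebraMap F K W.b₂ = (W.baseChange K).b₂ := by
    simp only [WeierstrassCurve.baseChange, map_b₂]
  simp only [frobSubNum, map_sub, map_mul, map_add, map_pow, map_one, aeval_X, aeval_C, hx, hb,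
    map_ofNat]
  generalize 2 * y + (W.baseChange K).a₁ * x + (W.baseChange K).a₃ = ψ
  generalize x ^ Fintype.card F = z
  have hpow : ψ ^ Fintype.card F = (ψ ^ 2) ^ (Fintype.card F / 2) * ψ := by
    rw [← pow_mul, ← pow_succ]
    congr 1
    omega
  rw [hpow]
  ring

/-- The chord formula for πP - P needs x^q ≠ x, which is why the x-coordinates in the base field
form the exceptional set. -/
lemma exists_xRepresents_frob_sub_id [W.IsElliptic] (hF : ringChar F ≠ 2) :
    ∃ A B, XRepresents (Set.range (algebraMap F K)) (frob W K - AddMonoidHom.id _) A B ∧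
      max A.natDegree B.natDegree = Nat.card W.toAffine.Point := by
  obtain ⟨A, hA, hc, hd⟩ := exists_frobSubNum_eq W hF
  have hc' : IsCoprime (A.map (algebraMap F K)) ((frobSubDenom W).map (algebraMap F K)) := by
    simpa only [coe_mapRingHom] using hc.map (mapRingHom (algebraMap F K))
  refine ⟨A.map (algebraMap F K), (frobSubDenom W).map (algebraMap F K),
    ⟨hc', fun x y h hx ↦ ?_⟩, by rw [natDegree_map, natDegree_map, hd]⟩
  rw [mem_range_algebraMap_iff] at hx
  have e1 := congrArg (aeval x) hA
  have e2 := congrArg (aeval x) (frobSubGcd_mul_denom W hF)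
  rw [map_mul, aeval_frobSubNum hF h] at e1
  rw [map_mul, map_mul, aeval_C, map_ofNat, map_pow, map_sub, map_pow, aeval_X] at e2
  obtain ⟨h', e⟩ := frob_some h
  rw [AddMonoidHom.sub_apply, AddMonoidHom.id_apply, e, sub_eq_add_neg, Point.neg_some,
    Point.add_of_X_ne hx, Point.xRep_some]
  have h4 := four_addX (W := W.baseChange K) (y₁ := y ^ Fintype.card F)
    (y₂ := (W.baseChange K).toAffine.negY x y) hx
  have hn : 2 * (W.baseChange K).toAffine.negY x y + (W.baseChange K).a₁ * x + (W.baseChange K).a₃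
      = -(2 * y + (W.baseChange K).a₁ * x + (W.baseChange K).a₃) := by
    rw [negY]; ring
  rw [psi_frob, hn, sub_neg_eq_add, e1, ← e2] at h4
  have h4' : (4 : K) ≠ 0 := by
    have h2 : (2 : K) ≠ 0 := by
      rw [← map_ofNat (algebraMap F K)]
      exact (_root_.map_ne_zero _).2 (Ring.two_ne_zero hF)
    rw [show (4 : K) = 2 * 2 by norm_num]
    exact mul_ne_zero h2 h2
  have hne : aeval x (frobSubGcd W) * aeval x (frobSubDenom W) ≠ 0 := by
    rw [e2]
    exact mul_ne_zero h4' (pow_ne_zero _ (sub_ne_zero.2 hx))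
  refine mul_left_cancel₀ (left_ne_zero_of_mul hne) ?_
  rw [eval_map_algebraMap, eval_map_algebraMap, ← mul_assoc, ← mul_assoc]
  simp only [Matrix.cons_val_zero, Matrix.cons_val_one]
  rw [h4, mul_one]

variable [IsAlgClosed K] [W.IsElliptic]

/-- The degree of `π + n` is `n² + a n + q`. -/
theorem exists_xRepresents_frob_add (hF : ringChar F ≠ 2) (n : ℤ) :
    ∃ A B, XRepresents (Set.range (algebraMap F K)) (frob W K + n • AddMonoidHom.id _) A B ∧
      ((max A.natDegree B.natDegree : ℕ) : ℤ) =
        n ^ 2 + frobeniusTrace W * n + Fintype.card F := by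
  have h2 : (2 : K) ≠ 0 := by
    rw [← map_ofNat (algebraMap F K)]
    exact (_root_.map_ne_zero _).2 (Ring.two_ne_zero hF)
  have : (W.baseChange K).IsElliptic := inferInstanceAs (W.map _).IsElliptic
  have hS : (Set.range (algebraMap F K)).Finite := Set.finite_range _
  -- The parallelogram law is a recurrence of order two, so the induction carries the values at n
  -- and n - 1; it runs in both directions from n = 0.
  suffices H : ∀ n : ℤ, (∃ A B, XRepresents (Set.range (algebraMap F K))
      (frob W K + n • AddMonoidHom.id _) A B ∧
      ((max A.natDegree B.natDegree : ℕ) : ℤ) =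
        n ^ 2 + frobeniusTrace W * n + Fintype.card F) ∧ 
      (∃ A B, XRepresents (Set.range (algebraMap F K))
      (frob W K + (n - 1) • AddMonoidHom.id _) A B ∧
      ((max A.natDegree B.natDegree : ℕ) : ℤ) =
        (n - 1) ^ 2 + frobeniusTrace W * (n - 1) + Fintype.card F) from (H n).1
  intro n
  induction n using Int.induction_on with
  | zero =>
    refine ⟨⟨_, _, by simpa using xRepresents_frob W K _, by simp⟩, ?_⟩
    obtain ⟨A, B, h, hd⟩ := exists_xRepresents_frob_sub_id W K hF
    refine ⟨A, B, by simpa [sub_eq_add_neg] using h, ?_⟩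
    rw [hd, frobeniusTrace]
    ring
  | succ n ih =>
    obtain ⟨⟨A, B, h, hd⟩, C, D, h', hd'⟩ := ih
    rw [sub_zsmul, one_zsmul, ← sub_eq_add_neg, ← add_sub_assoc] at h'
    obtain ⟨U, V, hUV, hdUV⟩ := h.add h2 hS (xRepresents_id W K _) h'
    rw [add_sub_cancel_right, add_zsmul, one_zsmul, ← add_assoc]
    refine ⟨⟨U, V, hUV, ?_⟩, A, B, h, hd⟩
    rw [natDegree_X, natDegree_one] at hdUV
    zify at hdUV hd hd' ⊢
    norm_num at hdUV
    linear_combination hdUV - hd' + 2 * hd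
  | pred n ih =>
    obtain ⟨⟨A, B, h, hd⟩, C, D, h', hd'⟩ := ih
    refine ⟨⟨C, D, h', hd'⟩, ?_⟩
    have h'' : XRepresents (Set.range (algebraMap F K))
        (frob W K + (-(n : ℤ) - 1) • AddMonoidHom.id _ - -AddMonoidHom.id _) A B := by
      rw [sub_zsmul, one_zsmul]
      convert! h using 1
      abel
    obtain ⟨U, V, hUV, hdUV⟩ := h'.add h2 hS (xRepresents_neg_id W K _) h''
    refine ⟨U, V, ?_, ?_⟩
    · rw [sub_zsmul _ _ 1, one_zsmul, ← add_assoc]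
      exact hUV
    rw [natDegree_X, natDegree_one] at hdUV
    zify at hdUV hd hd' ⊢
    norm_num at hdUV
    linear_combination hdUV - hd + 2 * hd'

end Frobenius

/-! ### Kernels of represented endomorphisms -/

section Kernel

variable {K : Type*} [Field K] [IsAlgClosed K] {W : WeierstrassCurve K} [W.IsElliptic]

/-- Two points with the same x are equal or opposite; the extra 1 is the point at infinity. -/
lemma exists_finset_of_x_mem (h2 : (2 : K) ≠ 0) (T : Finset K) :
    ∃ s : Finset W.toAffine.Point, s.card ≤ 2 * T.card + 1 ∧
      ∀ P : W.toAffine.Point, (∀ x y h, P = .some x y h → x ∈ T) → P ∈ s := by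
  classical
  choose y hy using exists_nonsingular (W := W) h2
  refine ⟨insert 0 (T.image (fun x ↦ Point.some x (y x) (hy x)) ∪
    T.image (fun x ↦ -Point.some x (y x) (hy x))), ?_, fun P hP ↦ ?_⟩
  · refine (Finset.card_insert_le _ _).trans ?_
    have h1 := Finset.card_union_le (T.image (fun x ↦ Point.some x (y x) (hy x)))
      (T.image (fun x ↦ -Point.some x (y x) (hy x)))
    have h2 := Finset.card_image_le (s := T) (f := fun x ↦ Point.some x (y x) (hy x))
    have h3 := Finset.card_image_le (s := T) (f := fun x ↦ -Point.some x (y x) (hy x))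
    omega
  · rcases P with _ | ⟨x, y', h⟩
    · exact Finset.mem_insert_self _ _
    · have hx := hP x y' h rfl
      rcases (Point.X_eq_iff (h₁ := h) (h₂ := hy x)).1 rfl with e | e
      · exact Finset.mem_insert_of_mem (Finset.mem_union_left _ (Finset.mem_image.2 ⟨x, hx, e.symm⟩))
      · exact Finset.mem_insert_of_mem
          (Finset.mem_union_right _ (Finset.mem_image.2 ⟨x, hx, e.symm⟩))

lemma infinite_point (h2 : (2 : K) ≠ 0) : Infinite W.toAffine.Point := by
  choose y hy using exists_nonsingular (W := W) h2
  have : Infinite K := IsAlgClosed.instInfinite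
  refine Infinite.of_injective (fun x ↦ Point.some x (y x) (hy x)) fun a b h ↦ ?_
  exact (Point.some.inj h).1

variable [DecidableEq K] {S : Set K} {g : W.toAffine.Point →+ W.toAffine.Point} {A B : K[X]}

lemma XRepresents.ncard_ker_le (h2 : (2 : K) ≠ 0) (hS : S.Finite) (h : XRepresents S g A B)
    (hB : B ≠ 0) : {P | g P = 0}.Finite ∧
      {P | g P = 0}.ncard ≤ 2 * (B.natDegree + S.ncard) + 1 := by
  obtain ⟨s, hs, hmem⟩ := exists_finset_of_x_mem (W := W) h2 (B.roots.toFinset ∪ hS.toFinset)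
  have hsub : {P | g P = 0} ⊆ (s : Set W.toAffine.Point) := by
    intro P hP
    refine hmem P fun x y hxy hPe ↦ ?_
    rw [Finset.mem_union, Multiset.mem_toFinset, Set.Finite.mem_toFinset, or_iff_not_imp_right]
    intro hx
    have := h.eval_eq x y hxy hx
    rw [← hPe, hP] at this
    rw [mem_roots hB]
    simpa using this.symm
  refine ⟨s.finite_toSet.subset hsub, ?_⟩
  refine (Set.ncard_le_ncard hsub s.finite_toSet).trans ?_
  rw [Set.ncard_coe_finset]
  have h1 := Finset.card_union_le B.roots.toFinset hS.toFinset
  have h2 := (Multiset.toFinset_card_le B.roots).trans (card_roots' B)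
  rw [← Set.ncard_eq_toFinset_card S hS] at h1
  omega

/-- In degree zero x(gP) is constant off a finite set. If it is infinity, g vanishes there, hence
everywhere since each point is a difference of generic ones. If it is finite, generic R and R'
satisfy gR = ±gR', so g kills R - R' or R + R', which are again generic, a contradiction. -/
lemma XRepresents.eq_zero (h2 : (2 : K) ≠ 0) (hS : S.Finite) (h : XRepresents S g A B)
    (hd : max A.natDegree B.natDegree = 0) : g = 0 := by
  have hinf := infinite_point (W := W) h2
  obtain ⟨N, -, hN⟩ := exists_finset_of_x_mem (W := W) h2 hS.toFinset
  rw [← Nat.le_zero, max_le_iff, Nat.le_zero, Nat.le_zero] at hd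
  rw [natDegree_eq_zero, natDegree_eq_zero] at hd
  obtain ⟨⟨a, rfl⟩, ⟨b, rfl⟩⟩ := hd
  have hab : a ≠ 0 ∨ b ≠ 0 := by simpa using aeval_ne_zero_of_isCoprime h.isCoprime (0 : K)
  have key (P : W.toAffine.Point) (hP : P ∉ N) : a * (g P).xRep 1 = b * (g P).xRep 0 := by
    by_contra hne
    refine hP (hN P ?_)
    rintro x y hxy rfl
    rw [Set.Finite.mem_toFinset]
    by_contra hx
    exact hne (by simpa using h.eval_eq x y hxy hx)
  have avoid (P : W.toAffine.Point) : ∃ R, R ∉ N ∧ P + R ∉ N ∧ P - R ∉ N := by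
    have hfin : ((N : Set W.toAffine.Point) ∪ (fun R ↦ P + R) ⁻¹' N ∪ (fun R ↦ P - R) ⁻¹' N).Finite :=
      (N.finite_toSet.union (N.finite_toSet.preimage (add_right_injective P).injOn)).union
        (N.finite_toSet.preimage (sub_right_injective).injOn)
    obtain ⟨R, hR⟩ := hfin.infinite_compl.nonempty
    simp only [Set.mem_compl_iff, Set.mem_union, Set.mem_preimage, not_or, Finset.mem_coe] at hR
    exact ⟨R, hR.1.1, hR.1.2, hR.2⟩
  by_cases hb : b = 0
  · have ha := hab.resolve_right (not_not.2 hb)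
    have hz (P : W.toAffine.Point) (hP : P ∉ N) : g P = 0 := by
      have := key P hP
      rw [hb, zero_mul, mul_eq_zero, or_iff_right ha] at this
      rcases hgP : g P with _ | ⟨x, y, hxy⟩
      · rfl
      · simp [hgP] at this
    ext1 P
    obtain ⟨R, h1, h2, -⟩ := avoid P
    have := hz _ h2
    rwa [map_add, hz R h1, add_zero] at this
  · exfalso
    have hz (P : W.toAffine.Point) (hP : P ∉ N) : g P ≠ 0 ∧ (g P).xRep = ![a / b, 1] := by
      have := key P hP
      rcases hgP : g P with _ | ⟨x, y, hxy⟩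
      · simp [hgP, ← Point.zero_def] at this
        exact absurd this.symm hb
      · refine ⟨Point.some_ne_zero _, ?_⟩
        simp [hgP] at this
        rw [Point.xRep_some, this]
        field_simp
    obtain ⟨R, h1, -, -⟩ := avoid 0
    obtain ⟨R', h1', h2', h3'⟩ := avoid R
    rcases Point.eq_or_eq_neg_of_xRep_eq_xRep ((hz R h1).2.trans (hz R' h1').2.symm) with e | e
    · exact (hz _ h3').1 (by rw [map_sub, e, sub_self])
    · exact (hz _ h2').1 (by rw [map_add, e, neg_add_cancel])

end Kernel

/-! ### Consequences for the Frobenius -/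

section Frobenius

variable {F : Type*} [Field F] [Fintype F] (W : WeierstrassCurve F) [W.IsElliptic]
  (K : Type*) [Field K] [Algebra F K] [DecidableEq K] [IsAlgClosed K]

omit [Fintype F] [DecidableEq K] [IsAlgClosed K] in
lemma algebra_two_ne_zero (hF : ringChar F ≠ 2) : (2 : K) ≠ 0 := by
  rw [← map_ofNat (algebraMap F K)]
  exact (_root_.map_ne_zero _).2 (Ring.two_ne_zero hF)

/-- If the discriminant of the characteristic polynomial of the Frobenius vanishes, then the
Frobenius is multiplication by an odd integer. -/
theorem exists_frob_eq_zsmul (hF : ringChar F ≠ 2)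
    (h : frobeniusTrace W ^ 2 = 4 * Fintype.card F) :
    ∃ m : ℤ, Odd m ∧ ∀ P, frob W K P = m • P := by
  have : (W.baseChange K).IsElliptic := inferInstanceAs (W.map _).IsElliptic
  have h2 := algebra_two_ne_zero (F := F) K hF
  have heven : Even (frobeniusTrace W) := by
    have : Even (frobeniusTrace W ^ 2) := ⟨2 * Fintype.card F, by rw [h]; ring⟩
    exact (Int.even_pow.1 this).1
  obtain ⟨m, hm⟩ := heven
  rw [hm] at h
  have hm2 : m ^ 2 = Fintype.card F := by linarith
  -- The degree form n² + 2mn + m² has the double root n = -m.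
  obtain ⟨A, B, hAB, hd⟩ := exists_xRepresents_frob_add W K hF (-m)
  have hd0 : ((max A.natDegree B.natDegree : ℕ) : ℤ) = 0 := by
    rw [hd, hm]; linear_combination -hm2
  have h0 := hAB.eq_zero h2 (Set.finite_range _) (by exact_mod_cast hd0)
  refine ⟨m, ?_, fun P ↦ ?_⟩
  · have hodd : Odd (m ^ 2) := by
      rw [hm2, Int.odd_coe_nat, Nat.odd_iff]
      exact FiniteField.odd_card_of_char_ne_two hF
    simpa [Int.odd_pow] using hodd
  · have := DFunLike.congr_fun h0 P
    simp only [neg_zsmul, AddMonoidHom.add_apply, AddMonoidHom.neg_apply,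
      AddMonoidHom.zsmul_apply, AddMonoidHom.id_apply, AddMonoidHom.zero_apply] at this
    exact add_neg_eq_zero.1 this

/-- The kernel of `π + n` has at most about `2 (n² + a n + q)` elements. -/
theorem ncard_ker_frob_add_le (hF : ringChar F ≠ 2)
    (h : frobeniusTrace W ^ 2 ≠ 4 * Fintype.card F) (n : ℤ) :
    {P | frob W K P + n • P = 0}.Finite ∧
    ({P | frob W K P + n • P = 0}.ncard : ℤ) ≤
      2 * (n ^ 2 + frobeniusTrace W * n + 2 * Fintype.card F) + 1 := by
  have : (W.baseChange K).IsElliptic := inferInstanceAs (W.map _).IsElliptic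
  have h2 := algebra_two_ne_zero (F := F) K hF
  obtain ⟨A, B, hAB, hd⟩ := exists_xRepresents_frob_add W K hF n
  -- If B = 0 then n is a root of the degree form. Nonnegativity at n ± 1 gives |2n + a| ≤ 1. The
  -- two roots n and -a - n have odd product q, so a is even; hence a = -2n and the discriminant
  -- vanishes.
  have hB : B ≠ 0 := by
    rintro rfl
    have hA : A.natDegree = 0 := natDegree_eq_zero_of_isUnit (isCoprime_zero_right.1 hAB.isCoprime)
    rw [hA, natDegree_zero, max_self, Nat.cast_zero] at hd
    have hpos (m : ℤ) : 0 ≤ m ^ 2 + frobeniusTrace W * m + Fintype.card F := by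
      obtain ⟨_, _, -, hd'⟩ := exists_xRepresents_frob_add W K hF m
      rw [← hd']
      positivity
    have hodd : Odd (Fintype.card F : ℤ) := by
      rw [Int.odd_coe_nat, Nat.odd_iff]
      exact FiniteField.odd_card_of_char_ne_two hF
    set a := frobeniusTrace W
    have hq : (Fintype.card F : ℤ) = n * (-a - n) := by linear_combination -hd
    rw [hq] at h hodd hpos
    rw [Int.odd_mul] at hodd
    obtain ⟨⟨k, hk⟩, ⟨l, hl⟩⟩ := hodd
    have h1 := hpos (n + 1)
    have h2 := hpos (n - 1)
    have h1' : 0 ≤ 2 * n + 1 + a := by linear_combination h1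
    have h2' : 0 ≤ 1 - 2 * n - a := by linear_combination h2
    have e : a = -2 * n := by omega
    exact h (by rw [e]; ring)
  obtain ⟨hfin, hle⟩ := hAB.ncard_ker_le h2 (Set.finite_range _) hB
  refine ⟨hfin, ?_⟩
  have hr : (Set.range (algebraMap F K)).ncard ≤ Fintype.card F := by
    rw [← Set.image_univ, ← Nat.card_eq_fintype_card, ← Set.ncard_univ]
    exact Set.ncard_image_le
  have hm := le_max_right A.natDegree B.natDegree
  have hle' : {P | frob W K P + n • P = 0}.ncard ≤
    2 * (max A.natDegree B.natDegree + Fintype.card F) + 1 := by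
    refine hle.trans ?_
    omega
  zify at hle'
  push_cast at hd hle'
  rw [hd] at hle'
  linarith

end Frobenius

end EllipticIsogeny

namespace EllipticIsogeny

open WeierstrassCurve WeierstrassCurve.Affine

/-! ### Abelian group lemmas -/

section GroupTheory

variable {A B : Type*} [AddCommGroup A] [AddCommGroup B]

/-- Expanding φ(P + Q + R) in two ways for a generic R gives the claim. This spares the exceptional
cases of the addition law. -/
lemma map_add_of_generic [Infinite A] (φ : A → B)
    (h : ∀ P, {Q | φ (P + Q) ≠ φ P + φ Q}.Finite) (P Q : A) : φ (P + Q) = φ P + φ Q := by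
  have hfin : ({R | φ (P + Q + R) ≠ φ (P + Q) + φ R} ∪ {R | φ (Q + R) ≠ φ Q + φ R} ∪
      (fun R ↦ Q + R) ⁻¹' {R | φ (P + R) ≠ φ P + φ R}).Finite :=
    ((h _).union (h _)).union ((h _).preimage (add_right_injective Q).injOn)
  obtain ⟨R, hR⟩ := hfin.infinite_compl.nonempty
  simp only [Set.mem_compl_iff, Set.mem_union, Set.mem_preimage, not_or, Set.mem_ofPred_eq,
    not_not] at hR
  obtain ⟨⟨h1, h2⟩, h3⟩ := hR
  rw [add_assoc, h3, h2, ← add_assoc] at h1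
  exact (add_right_cancel h1).symm

/-- An endomorphism preserving all cyclic subgroups of 2-power order acts as a scalar on the
`2 ^ k`-torsion. -/
lemma exists_zsmul_eq_of_forall_mem_zmultiples (π : A →+ A)
    (h : ∀ (k : ℕ) (P : A), 2 ^ k • P = 0 → ∃ j : ℤ, π P = j • P) (k : ℕ) :
    ∃ s : ℤ, ∀ P : A, 2 ^ k • P = 0 → π P = s • P := by
  induction k with
  | zero => exact ⟨0, fun P hP ↦ by rw [pow_zero, one_smul] at hP; simp [hP]⟩
  | succ k ih =>
    obtain ⟨s, hs⟩ := ih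
    have key (P : A) (hP : 2 ^ (k + 1) • P = 0) : π P - s • P = 0 ∨ π P - s • P = 2 ^ k • P := by
      by_cases hT : 2 ^ k • P = 0
      · exact .inl (sub_eq_zero.2 (hs P hT))
      obtain ⟨j, hj⟩ := h _ P hP
      have h2 : π (2 • P) = s • (2 • P) := hs _ (by rw [smul_smul, ← pow_succ]; exact hP)
      have hord : addOrderOf P = 2 ^ (k + 1) := addOrderOf_eq_prime_pow hT hP
      -- Since 2P lies in the 2^k-torsion, where π is already s, the scalar j of P is congruent to s
      -- modulo 2^k.
      have hdvd : ((2 ^ (k + 1) : ℕ) : ℤ) ∣ (j - s) * 2 := by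
        rw [← hord, addOrderOf_dvd_iff_zsmul_eq_zero, mul_smul, sub_smul, sub_eq_zero]
        have e : (2 : ℤ) • P = 2 • P := ofNat_zsmul P 2
        rw [e, ← h2, map_nsmul, hj, smul_comm]
      rw [pow_succ, Nat.cast_mul] at hdvd
      obtain ⟨m, hm⟩ := Int.dvd_of_mul_dvd_mul_right (by norm_num) hdvd
      have e : π P - s • P = m • (2 ^ k • P) := by
        rw [hj, ← sub_smul, hm, mul_comm, mul_smul, natCast_zsmul]
      rw [e]
      have h0 : (2 : ℤ) • (2 ^ k • P) = 0 := by
        rw [ofNat_zsmul, smul_smul, ← pow_succ']; exact hP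
      rcases Int.even_or_odd' m with ⟨l, rfl | rfl⟩
      · left; rw [mul_comm, mul_smul, h0, smul_zero]
      · right; rw [add_smul, mul_comm, mul_smul, h0, smul_zero, zero_add, one_smul]
    by_cases hall : ∀ P : A, 2 ^ (k + 1) • P = 0 → π P - s • P = 0
    · exact ⟨s, fun P hP ↦ sub_eq_zero.1 (hall P hP)⟩
    push Not at hall
    obtain ⟨P₀, hP₀, hN₀⟩ := hall
    have hT₀ := (key P₀ hP₀).resolve_left hN₀
    -- Once s fails at P₀, the other lift s + 2^k must work. A point P of exact order 2^(k+1)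
    -- obeying s is excluded by testing P - P₀ when 2^k P = 2^k P₀, and P + P₀ otherwise.
    refine ⟨s + 2 ^ k, fun P hP ↦ ?_⟩
    rw [add_smul, ← sub_eq_iff_eq_add']
    have e : (2 ^ k : ℤ) • P = 2 ^ k • P := by rw [← natCast_zsmul]; norm_cast
    rw [e]
    by_cases hT : 2 ^ k • P = 0
    · rw [hT, sub_eq_zero]; exact hs P hT
    refine (key P hP).resolve_left fun h0 ↦ ?_
    by_cases hTT : 2 ^ k • P = 2 ^ k • P₀
    · have := hs (P - P₀) (by rw [smul_sub, hTT, sub_self])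
      rw [map_sub, smul_sub, sub_eq_sub_iff_sub_eq_sub, h0] at this
      exact hN₀ this.symm
    · have hN : π (P + P₀) - s • (P + P₀) = 2 ^ k • P₀ := by
        rw [map_add, smul_add, add_sub_add_comm, h0, zero_add, hT₀]
      rcases key (P + P₀) (by rw [smul_add, hP, hP₀, add_zero]) with h' | h' <;> rw [hN] at h'
      · exact hN₀ (hT₀.trans h')
      · rw [smul_add, right_eq_add] at h'
        exact hT h'

/-- Each point has four halves, the translates of one of them by the 2-torsion; doubling recovers
the point, so no half is counted twice. -/
lemma exists_finset_two_pow_torsion (hdiv : ∀ P : A, ∃ Q, Q + Q = P)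
    (h4 : {P : A | P + P = 0}.ncard = 4) (k : ℕ) :
    ∃ s : Finset A, s.card = 4 ^ k ∧ ∀ P ∈ s, 2 ^ k • P = 0 := by
  classical
  choose d hd using hdiv
  have hfin : {P : A | P + P = 0}.Finite := Set.finite_of_ncard_ne_zero (by rw [h4]; norm_num)
  induction k with
  | zero => exact ⟨{0}, by simp, by simp⟩
  | succ k ih =>
    obtain ⟨s, hs, hmem⟩ := ih
    refine ⟨(hfin.toFinset ×ˢ s).image fun p ↦ p.1 + d p.2, ?_, ?_⟩
    · rw [Finset.card_image_of_injOn, Finset.card_product, hs, ← Set.ncard_eq_toFinset_card _ hfin, h4,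
        pow_succ']
      rintro ⟨T, Q⟩ h ⟨T', Q'⟩ h' e
      simp only [Finset.coe_product, Set.mem_prod, Finset.mem_coe, Set.Finite.mem_toFinset,
        Set.mem_ofPred_eq] at h h' e
      have hQ : Q = Q' := by
        rw [← hd Q, ← hd Q']
        calc d Q + d Q = (T + d Q) + (T + d Q) - (T + T) := by abel
          _ = (T' + d Q') + (T' + d Q') - (T' + T') := by rw [e, h.1, h'.1]
          _ = d Q' + d Q' := by abel
      subst hQ
      rw [add_right_cancel e]
    · intro P hP
      obtain ⟨⟨T, Q⟩, h, rfl⟩ := Finset.mem_image.1 hP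
      simp only [Finset.mem_product, Set.Finite.mem_toFinset, Set.mem_ofPred_eq] at h
      have : 2 • (T + d Q) = Q := by
        rw [smul_add, two_nsmul, two_nsmul, h.1, hd, zero_add]
      rw [pow_succ, mul_smul, this]
      exact hmem Q h.2

end GroupTheory

/-! ### Composition of isogenies and commutation with Frobenius -/

section Isogeny

variable {F : Type*} [Field F]

lemma homCoords_eq_of_eq_mul {K : Type*} [Field K] {W : WeierstrassCurve K} {P Q : W.toAffine.Point}
    {c : K} (hc : c ≠ 0) (h : ∀ i, homCoords P i = c * homCoords Q i) : P = Q := by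
  have h0 := h 0
  have h1 := h 1
  have h2 := h 2
  rcases P with _ | ⟨x, y, hP⟩ <;> rcases Q with _ | ⟨x', y', hQ⟩ <;> simp [homCoords] at h0 h1 h2
  · rfl
  · exact absurd h2.symm hc
  · subst h2
    simp at h0 h1
    subst h0 h1
    rfl

lemma homCoords_ne_zero {K : Type*} [Field K] {W : WeierstrassCurve K} (P : W.toAffine.Point) :
    ∃ i, homCoords P i ≠ 0 := by
  rcases P with _ | ⟨x, y, hP⟩
  · exact ⟨1, by simp [homCoords]⟩
  · exact ⟨2, by simp [homCoords]⟩

lemma aeval_mul_of_isHomogeneous {R : Type*} [CommRing R] [Algebra F R] {d : ℕ}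
    {f : MvPolynomial (Fin 3) F} (hf : f.IsHomogeneous d) (c : R) (v : Fin 3 → R) :
    MvPolynomial.aeval (fun i ↦ c * v i) f = c ^ d * MvPolynomial.aeval v f := by
  rw [MvPolynomial.aeval_def, MvPolynomial.aeval_def, MvPolynomial.eval₂_eq, MvPolynomial.eval₂_eq,
    Finset.mul_sum]
  refine Finset.sum_congr rfl fun m hm ↦ ?_
  simp only [mul_pow]
  rw [Finset.prod_mul_distrib, Finset.prod_pow_eq_pow_sum, ← hf.degree_eq_sum_deg_support hm]
  ring

lemma IsMorphismOver.comp {W W' W'' : WeierstrassCurve F} {φ : GeomPoint W → GeomPoint W'}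
    {ψ : GeomPoint W' → GeomPoint W''} (hψ : IsMorphismOver W' W'' ψ)
    (hφ : IsMorphismOver W W' φ) : IsMorphismOver W W'' (ψ ∘ φ) := by
  intro P
  obtain ⟨d, f, hfd, hfP, hf⟩ := hφ P
  obtain ⟨e, g, hge, hgP, hg⟩ := hψ (φ P)
  have hcomp (Q : GeomPoint W) (i : Fin 3) : MvPolynomial.aeval (homCoords Q)
      (MvPolynomial.bind₁ f (g i)) =
        MvPolynomial.aeval (fun j ↦ MvPolynomial.aeval (homCoords Q) (f j)) (g i) := by
    rw [MvPolynomial.aeval_bind₁]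
  have hrel {Q : GeomPoint W} (hQ : ∃ i, MvPolynomial.aeval (homCoords Q) (f i) ≠ 0) :
      ∃ c : AlgebraicClosure F, c ≠ 0 ∧ ∀ i, MvPolynomial.aeval (homCoords (φ Q)) (g i) =
        c * MvPolynomial.aeval (homCoords Q) (MvPolynomial.bind₁ f (g i)) := by
    obtain ⟨c, hc, h⟩ := hf Q hQ
    refine ⟨c ^ e, pow_ne_zero _ hc, fun i ↦ ?_⟩
    rw [hcomp, ← aeval_mul_of_isHomogeneous (hge i), ← funext h]
  refine ⟨d * e, fun i ↦ MvPolynomial.bind₁ f (g i), fun i ↦ (hge i).aeval f hfd, ?_, ?_⟩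
  · obtain ⟨c, hc, h⟩ := hrel hfP
    obtain ⟨i, hi⟩ := hgP
    rw [h] at hi
    exact ⟨i, right_ne_zero_of_mul hi⟩
  · rintro Q ⟨i, hi⟩
    have hrelQ : ∃ c : AlgebraicClosure F, c ≠ 0 ∧ ∀ i,
        MvPolynomial.aeval (homCoords (φ Q)) (g i) =
        c * MvPolynomial.aeval (homCoords Q) (MvPolynomial.bind₁ f (g i)) := by
      by_cases hQ : ∃ i, MvPolynomial.aeval (homCoords Q) (f i) ≠ 0
      · exact hrel hQ
      -- If all f vanish at Q but some g ∘ f does not, the degree e must be 0, so the g are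
      -- constants and the representation still applies.
      push Not at hQ
      have h0 (j : Fin 3) : MvPolynomial.aeval (homCoords Q) (MvPolynomial.bind₁ f (g j)) =
          0 ^ e * MvPolynomial.aeval (homCoords (φ Q)) (g j) := by
        rw [hcomp, ← aeval_mul_of_isHomogeneous (hge j)]
        simp only [hQ, zero_mul]
      rw [h0] at hi
      have he : e = 0 := by
        by_contra he
        simp [he] at hi
      refine ⟨1, one_ne_zero, fun j ↦ ?_⟩
      rw [h0, he, pow_zero, one_mul, one_mul]
    obtain ⟨c, hc, h⟩ := hrelQ
    obtain ⟨c', hc', h'⟩ := hg (φ Q) ⟨i, by rw [h]; exact mul_ne_zero hc hi⟩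
    refine ⟨c' * c, mul_ne_zero hc' hc, fun j ↦ ?_⟩
    rw [Function.comp_apply, h', h, mul_assoc]

lemma isMorphismOver_id (W : WeierstrassCurve F) : IsMorphismOver W W id := fun P ↦
  ⟨1, MvPolynomial.X, fun i ↦ MvPolynomial.isHomogeneous_X _ i,
    by simpa using homCoords_ne_zero P, fun Q _ ↦ ⟨1, one_ne_zero, fun i ↦ by simp⟩⟩

open scoped Classical in
lemma Isogenous.refl (W : WeierstrassCurve F) : Isogenous W W :=
  ⟨AddMonoidHom.id _, isMorphismOver_id W, Function.surjective_id, by simp⟩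

open scoped Classical in
lemma IsIsogeny.comp {W W' W'' : WeierstrassCurve F} {φ : GeomPoint W →+ GeomPoint W'}
    {ψ : GeomPoint W' →+ GeomPoint W''} (hψ : IsIsogeny W' W'' ψ) (hφ : IsIsogeny W W' φ) :
    IsIsogeny W W'' (ψ.comp φ) := by
  refine ⟨hψ.1.comp hφ.1, hψ.2.comp hφ.2, ?_⟩
  have : ((ψ.comp φ).ker : Set (GeomPoint W)) = ⋃ Q ∈ (ψ.ker : Set (GeomPoint W')), φ ⁻¹' {Q} := by
    ext P; simp
  rw [this]
  refine hψ.3.biUnion fun Q _ ↦ ?_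
  obtain ⟨P, rfl⟩ := hφ.2 Q
  refine (hφ.3.image (fun R ↦ P + R)).subset fun R hR ↦ ⟨R - P, ?_, by simp⟩
  simp only [Set.mem_preimage, Set.mem_singleton_iff] at hR
  simp [hR]

lemma Isogenous.trans {W W' W'' : WeierstrassCurve F} (h : Isogenous W W') (h' : Isogenous W' W'') :
    Isogenous W W'' :=
  let ⟨_, hφ⟩ := h
  let ⟨_, hψ⟩ := h'
  ⟨_, hψ.comp hφ⟩

open scoped Classical in
/-- A morphism defined over a finite field commutes with the Frobenius. -/
lemma IsMorphismOver.frob_comm [Fintype F] {W W' : WeierstrassCurve F}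
    {φ : GeomPoint W → GeomPoint W'} (hφ : IsMorphismOver W W' φ) (P : GeomPoint W) :
    φ (frob W (AlgebraicClosure F) P) = frob W' (AlgebraicClosure F) (φ P) := by
  set σ := FiniteField.frobeniusAlgHom F (AlgebraicClosure F)
  have hco {V : WeierstrassCurve F} (Q : GeomPoint V) :
      homCoords (frob V (AlgebraicClosure F) Q) = fun i ↦ σ (homCoords Q i) := by
    rcases Q with _ | ⟨x, y, h⟩
    · ext i; fin_cases i <;> simp [homCoords, frob, ← Point.zero_def]
    · ext i; fin_cases i <;> simp [homCoords, frob, Point.map_some, σ]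
  have hae (Q : GeomPoint W) (f : MvPolynomial (Fin 3) F) :
      MvPolynomial.aeval (homCoords (frob W (AlgebraicClosure F) Q)) f =
        σ (MvPolynomial.aeval (homCoords Q) f) := by
    rw [hco, ← AlgHom.comp_apply, MvPolynomial.comp_aeval]
  obtain ⟨d, f, -, hfP, hf⟩ := hφ P
  obtain ⟨c, hc, h⟩ := hf P hfP
  obtain ⟨c', hc', h'⟩ := hf (frob W (AlgebraicClosure F) P) (by
    obtain ⟨i, hi⟩ := hfP
    exact ⟨i, by rw [hae]; exact (_root_.map_ne_zero _).2 hi⟩)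
  have hσc : σ c ≠ 0 := (_root_.map_ne_zero _).2 hc
  refine homCoords_eq_of_eq_mul (div_ne_zero hc' hσc) fun i ↦ ?_
  rw [h', congrFun (hco (φ P)) i, h, hae, map_mul]
  field_simp

end Isogeny

/-! ### Changes of variables as isomorphisms -/

section Translate

variable {K : Type*} [Field K] {V V' : WeierstrassCurve K} {r s t : K}

lemma equation_translate (hV : V' = (⟨1, r, s, t⟩ : VariableChange K) • V) (x y : K) :
    V'.toAffine.Equation (x - r) (y - s * (x - r) - t) ↔ V.toAffine.Equation x y := by
  subst hV
  rw [equation_iff', equation_iff', variableChange_a₁, variableChange_a₂, variableChange_a₃,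
    variableChange_a₄, variableChange_a₆]
  simp only [inv_one, Units.val_one, one_pow, one_mul]
  constructor <;> intro h <;> linear_combination h

/-- The isomorphism of curves `(x, y) ↦ (x - r, y - s (x - r) - t)`. -/
def translate [V'.IsElliptic] (hV : V' = (⟨1, r, s, t⟩ : VariableChange K) • V) :
    V.toAffine.Point → V'.toAffine.Point
  | .zero => .zero
  | .some x y h => .some (x - r) (y - s * (x - r) - t)
    (equation_iff_nonsingular.1 ((equation_translate hV x y).2 h.1))

variable [V.IsElliptic] [V'.IsElliptic] [DecidableEq K] [IsAlgClosed K]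

/-- `translate` as a group homomorphism. -/
def translateHom (h2 : (2 : K) ≠ 0) (hV : V' = (⟨1, r, s, t⟩ : VariableChange K) • V) :
    V.toAffine.Point →+ V'.toAffine.Point where
  toFun := translate hV
  map_zero' := rfl
  map_add' := by
    have := infinite_point (W := V) h2
    refine map_add_of_generic _ fun P ↦ ?_
    have h0 : translate hV 0 = 0 := rfl
    rcases P with _ | ⟨x₁, y₁, h₁⟩
    · refine Set.finite_empty.subset fun Q hQ ↦ hQ ?_
      rw [← Point.zero_def, zero_add, h0, zero_add]
    · refine (Set.toFinite {.some x₁ y₁ h₁, -.some x₁ y₁ h₁}).subset fun Q hQ ↦ ?_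
      rcases Q with _ | ⟨x₂, y₂, h₂⟩
      · exact absurd (by rw [← Point.zero_def, add_zero, h0, add_zero]) hQ
      by_contra hx
      have hx : x₁ ≠ x₂ := fun e ↦ hx (by
        rcases (Point.X_eq_iff (h₁ := h₁) (h₂ := h₂)).1 e with e | e
        · exact .inl e.symm
        · exact .inr (by rw [e, neg_neg]; rfl))
      refine hQ ?_
      have hx' : x₁ - r ≠ x₂ - r := fun e ↦ hx (sub_left_injective e)
      have hd := sub_ne_zero.2 hx
      rw [Point.add_of_X_ne hx]
      simp only [translate]
      rw [Point.add_of_X_ne hx']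
      subst hV
      have hs : ((⟨1, r, s, t⟩ : VariableChange K) • V).toAffine.slope (x₁ - r) (x₂ - r)
          (y₁ - s * (x₁ - r) - t) (y₂ - s * (x₂ - r) - t) =
          V.toAffine.slope x₁ x₂ y₁ y₂ - s := by
        rw [slope_of_X_ne hx, slope_of_X_ne hx']
        have : x₁ - r - (x₂ - r) ≠ 0 := by rwa [sub_sub_sub_cancel_right]
        field_simp
        ring
      rw [Point.some.injEq, hs]
      generalize V.toAffine.slope x₁ x₂ y₁ y₂ = l
      simp only [addX, addY, negAddY, negY, variableChange_a₁, variableChange_a₂,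
        variableChange_a₃, inv_one, Units.val_one, one_pow, one_mul]
      constructor <;> ring

lemma translateHom_bijective (h2 : (2 : K) ≠ 0)
    (hV : V' = (⟨1, r, s, t⟩ : VariableChange K) • V) :
    Function.Bijective (translateHom h2 hV) := by
  constructor
  · rintro (_ | ⟨x₁, y₁, h₁⟩) (_ | ⟨x₂, y₂, h₂⟩) h
    · rfl
    · exact absurd h.symm (Point.some_ne_zero _)
    · exact absurd h (Point.some_ne_zero _)
    · obtain ⟨e1, e2⟩ := Point.some.inj h
      obtain rfl : x₁ = x₂ := sub_left_injective e1
      obtain rfl : y₁ = y₂ := by linear_combination e2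
      rfl
  · rintro (_ | ⟨x, y, h⟩)
    · exact ⟨0, rfl⟩
    · have h' : V.toAffine.Equation (x + r) (y + s * x + t) := by
        rw [← equation_translate hV]
        convert! h.1 using 1 <;> ring
      refine ⟨.some _ _ (equation_iff_nonsingular.1 h'), ?_⟩
      refine (Point.some.injEq ..).mpr ⟨?_, ?_⟩ <;> ring

end Translate

/-! ### The explicit 2-isogeny with kernel generated by (0, 0) -/

section TwoIsogeny

variable {K : Type*} [Field K] {V V' : WeierstrassCurve K} {a b : K}

lemma equation_iff_of_eq (hV : V = ⟨0, a, 0, b, 0⟩) (x y : K) :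
    V.toAffine.Equation x y ↔ y ^ 2 = x ^ 3 + a * x ^ 2 + b * x := by
  subst hV
  rw [equation_iff]
  simp

lemma equation_twoIsogeny (hV : V = ⟨0, a, 0, b, 0⟩)
    (hV' : V' = ⟨0, -2 * a, 0, a ^ 2 - 4 * b, 0⟩) {x y : K} (hx : x ≠ 0)
    (h : V.toAffine.Equation x y) :
    V'.toAffine.Equation (y ^ 2 / x ^ 2) (y * (x ^ 2 - b) / x ^ 2) := by
  rw [equation_iff_of_eq hV] at h
  rw [equation_iff_of_eq hV']
  have h' : y ^ 2 / x ^ 2 = (x ^ 2 + a * x + b) / x := by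
    rw [h]; field_simp
  have h'' : (y * (x ^ 2 - b) / x ^ 2) ^ 2 = (y ^ 2 / x ^ 2) * ((x ^ 2 - b) ^ 2 / x ^ 2) := by
    field_simp
  rw [h'', h']
  field_simp
  ring

open scoped Classical in
/-- The isogeny of degree two with kernel generated by `(0, 0)`. -/
noncomputable def twoIsogeny [V'.IsElliptic] (hV : V = ⟨0, a, 0, b, 0⟩)
    (hV' : V' = ⟨0, -2 * a, 0, a ^ 2 - 4 * b, 0⟩) : V.toAffine.Point → V'.toAffine.Point
  | .zero => .zero
  | .some x y h => if hx : x = 0 then .zero else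
    .some (y ^ 2 / x ^ 2) (y * (x ^ 2 - b) / x ^ 2)
      (equation_iff_nonsingular.1 (equation_twoIsogeny hV hV' hx h.1))

/-- Vieta's formulas for the cubic cut out by the line y = lx + m, the third root being l² - a - x₁
- x₂. -/
lemma vieta_line {x₁ x₂ l m : K} (hx : x₁ ≠ x₂)
    (h₁ : (l * x₁ + m) ^ 2 = x₁ ^ 3 + a * x₁ ^ 2 + b * x₁)
    (h₂ : (l * x₂ + m) ^ 2 = x₂ ^ 3 + a * x₂ ^ 2 + b * x₂) :
    x₁ * x₂ + (x₁ + x₂) * (l ^ 2 - a - x₁ - x₂) = b - 2 * l * m ∧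
      x₁ * x₂ * (l ^ 2 - a - x₁ - x₂) = m ^ 2 := by
  have e2 : x₁ * x₂ + (x₁ + x₂) * (l ^ 2 - a - x₁ - x₂) = b - 2 * l * m := by
    refine mul_left_cancel₀ (sub_ne_zero.2 hx) ?_
    linear_combination h₁ - h₂
  exact ⟨e2, by linear_combination x₁ * e2 - h₁⟩

/-- The isogeny carries the three intersections with a line not through (0, 0) to points of another
line; this is the source of its additivity. -/
lemma twoIsogeny_mem_line {x y l m : K} (hx : x ≠ 0) (hm : m ≠ 0) (hl : y = l * x + m)
    (h : y ^ 2 = x ^ 3 + a * x ^ 2 + b * x) :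
    y * (x ^ 2 - b) / x ^ 2 =
      (l * m - b) / m * (y ^ 2 / x ^ 2) + (m ^ 2 - a * l * m + b * l ^ 2) / m := by
  field_simp
  subst hl
  linear_combination (-l * m) * h

/-- On the curve y² / x² = x + a + b / x, so the sum over the three points is expressed through
their elementary symmetric functions. -/
lemma twoIsogeny_sum_X {x₁ x₂ x₃ y₁ y₂ y₃ l m : K} (hx₁ : x₁ ≠ 0) (hx₂ : x₂ ≠ 0) (hx₃ : x₃ ≠ 0)
    (hm : m ≠ 0) (h₁ : y₁ ^ 2 = x₁ ^ 3 + a * x₁ ^ 2 + b * x₁)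
    (h₂ : y₂ ^ 2 = x₂ ^ 3 + a * x₂ ^ 2 + b * x₂) (h₃ : y₃ ^ 2 = x₃ ^ 3 + a * x₃ ^ 2 + b * x₃)
    (e1 : x₃ = l ^ 2 - a - x₁ - x₂) (e2 : x₁ * x₂ + (x₁ + x₂) * x₃ = b - 2 * l * m)
    (e3 : x₁ * x₂ * x₃ = m ^ 2) :
    y₃ ^ 2 / x₃ ^ 2 = ((l * m - b) / m) ^ 2 + 2 * a - y₁ ^ 2 / x₁ ^ 2 - y₂ ^ 2 / x₂ ^ 2 := by
  have key {x y : K} (hx : x ≠ 0) (h : y ^ 2 = x ^ 3 + a * x ^ 2 + b * x) :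
      y ^ 2 / x ^ 2 = x + a + b / x := by
    rw [h]; field_simp
  rw [key hx₁ h₁, key hx₂ h₂, key hx₃ h₃]
  have hinv : b / x₁ + b / x₂ + b / x₃ = b * (b - 2 * l * m) / m ^ 2 := by
    rw [← e2, ← e3]
    field_simp
    ring
  have hsq : ((l * m - b) / m) ^ 2 = l ^ 2 + b * (b - 2 * l * m) / m ^ 2 := by
    field_simp
    ring
  linear_combination hinv - hsq + e1

variable [V'.IsElliptic]

lemma twoIsogeny_some (hV : V = ⟨0, a, 0, b, 0⟩) (hV' : V' = ⟨0, -2 * a, 0, a ^ 2 - 4 * b, 0⟩)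
    {x y : K} (h : V.toAffine.Nonsingular x y) (hx : x ≠ 0) :
    ∃ h', twoIsogeny hV hV' (.some x y h) =
      .some (y ^ 2 / x ^ 2) (y * (x ^ 2 - b) / x ^ 2) h' := by
  refine ⟨equation_iff_nonsingular.1 (equation_twoIsogeny hV hV' hx h.1), ?_⟩
  simp only [twoIsogeny]
  rw [dif_neg hx]

lemma twoIsogeny_of_eq_zero (hV : V = ⟨0, a, 0, b, 0⟩)
    (hV' : V' = ⟨0, -2 * a, 0, a ^ 2 - 4 * b, 0⟩)
    {x y : K} (h : V.toAffine.Nonsingular x y) (hx : x = 0) :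
    twoIsogeny hV hV' (.some x y h) = 0 := by
  simp only [twoIsogeny]
  rw [dif_pos hx]
  rfl

variable [DecidableEq K]

lemma twoIsogeny_add_of_ne (hV : V = ⟨0, a, 0, b, 0⟩)
    (hV' : V' = ⟨0, -2 * a, 0, a ^ 2 - 4 * b, 0⟩) {x₁ x₂ y₁ y₂ : K}
    (h₁ : V.toAffine.Nonsingular x₁ y₁) (h₂ : V.toAffine.Nonsingular x₂ y₂)
    (hx : x₁ ≠ x₂) (hx₁ : x₁ ≠ 0) (hx₂ : x₂ ≠ 0) (hb : x₁ * x₂ ≠ b)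
    (hx₃ : V.toAffine.addX x₁ x₂ (V.toAffine.slope x₁ x₂ y₁ y₂) ≠ 0) :
    twoIsogeny hV hV' (.some x₁ y₁ h₁ + .some x₂ y₂ h₂) =
      twoIsogeny hV hV' (.some x₁ y₁ h₁) + twoIsogeny hV hV' (.some x₂ y₂ h₂) := by
  have q₁ := (equation_iff_of_eq hV _ _).1 h₁.1
  have q₂ := (equation_iff_of_eq hV _ _).1 h₂.1
  have hX : y₁ ^ 2 / x₁ ^ 2 ≠ y₂ ^ 2 / x₂ ^ 2 := by
    intro e
    rw [q₁, q₂] at e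
    field_simp at e
    have : (x₁ - x₂) * (x₁ * x₂ - b) = 0 := by linear_combination e
    rcases mul_eq_zero.1 this with h | h
    · exact hx (sub_eq_zero.1 h)
    · exact hb (sub_eq_zero.1 h)
  rw [Point.add_of_X_ne hx]
  have h₃ := nonsingular_add h₁ h₂ (fun h ↦ hx h.1)
  obtain ⟨h₁', e₁⟩ := twoIsogeny_some hV hV' h₁ hx₁
  obtain ⟨h₂', e₂⟩ := twoIsogeny_some hV hV' h₂ hx₂
  obtain ⟨h₃', e₃⟩ := twoIsogeny_some hV hV' h₃ hx₃
  rw [e₁, e₂, e₃, Point.add_of_X_ne hX, Point.some.injEq]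
  have q₃ := (equation_iff_of_eq hV _ _).1 h₃.1
  have hl : V.toAffine.slope x₁ x₂ y₁ y₂ = (y₁ - y₂) / (x₁ - x₂) := slope_of_X_ne hx
  have hd := sub_ne_zero.2 hx
  clear e₁ e₂ e₃ h₁' h₂' h₃' h₃
  set l := V.toAffine.slope x₁ x₂ y₁ y₂
  clear_value l
  have hl₁ : y₁ = l * x₁ + (y₁ - l * x₁) := by ring
  have hl₂ : y₂ = l * x₂ + (y₁ - l * x₁) := by rw [hl]; field_simp; ring
  have hx3 : V.toAffine.addX x₁ x₂ l = l ^ 2 - a - x₁ - x₂ := by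
    rw [addX]; subst hV; simp
  have hy3 : V.toAffine.addY x₁ x₂ y₁ l = -(l * (l ^ 2 - a - x₁ - x₂) + (y₁ - l * x₁)) := by
    rw [addY, negAddY, hx3, negY]; subst hV; simp; ring
  rw [hx3] at hx₃
  rw [hx3, hy3] at q₃ ⊢
  set m := y₁ - l * x₁
  set x₃ := l ^ 2 - a - x₁ - x₂ with hx₃e
  clear_value m
  obtain ⟨v2, v3⟩ := vieta_line hx (hl₁ ▸ q₁) (hl₂ ▸ q₂)
  rw [← hx₃e] at v2 v3
  have hm : m ≠ 0 := by
    rintro rfl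
    exact mul_ne_zero (mul_ne_zero hx₁ hx₂) hx₃ (by rw [v3]; ring)
  have L₁ := twoIsogeny_mem_line hx₁ hm hl₁ q₁
  have L₂ := twoIsogeny_mem_line hx₂ hm hl₂ q₂
  have L₃ := twoIsogeny_mem_line (y := l * x₃ + m) hx₃ hm rfl (by rw [← neg_sq]; exact q₃)
  have hS : V'.toAffine.slope (y₁ ^ 2 / x₁ ^ 2) (y₂ ^ 2 / x₂ ^ 2)
      (y₁ * (x₁ ^ 2 - b) / x₁ ^ 2) (y₂ * (x₂ ^ 2 - b) / x₂ ^ 2) = (l * m - b) / m := by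
    rw [slope_of_X_ne hX, L₁, L₂, add_sub_add_right_eq_sub, ← mul_sub,
      mul_div_cancel_right₀ _ (sub_ne_zero.2 hX)]
  rw [hS]
  have hX3 := twoIsogeny_sum_X hx₁ hx₂ hx₃ hm q₁ q₂ q₃ hx₃e v2 v3
  have hX' : V'.toAffine.addX (y₁ ^ 2 / x₁ ^ 2) (y₂ ^ 2 / x₂ ^ 2) ((l * m - b) / m) =
      (-(l * x₃ + m)) ^ 2 / x₃ ^ 2 := by
    rw [addX, hX3]; subst hV'; simp
  refine ⟨hX'.symm, ?_⟩
  have hY' : V'.toAffine.addY (y₁ ^ 2 / x₁ ^ 2) (y₂ ^ 2 / x₂ ^ 2)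
      (y₁ * (x₁ ^ 2 - b) / x₁ ^ 2) ((l * m - b) / m) =
      -((l * m - b) / m * ((-(l * x₃ + m)) ^ 2 / x₃ ^ 2 - y₁ ^ 2 / x₁ ^ 2) +
        y₁ * (x₁ ^ 2 - b) / x₁ ^ 2) := by
    rw [addY, negAddY, hX', negY]; subst hV'; simp
  rw [hY', neg_mul, neg_div, L₃, L₁, neg_sq]
  ring

end TwoIsogeny

section TwoIsogenyHom

variable {K : Type*} [Field K] {V V' : WeierstrassCurve K} {a b : K}

lemma coeff_ne_zero_of_isElliptic [V.IsElliptic] (hV : V = ⟨0, a, 0, b, 0⟩) : b ≠ 0 := by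
  rintro rfl
  refine V.isUnit_Δ.ne_zero ?_
  subst hV
  simp [Δ, b₂, b₄, b₆, b₈]

lemma isElliptic_twoIsogeny [V.IsElliptic] (hV : V = ⟨0, a, 0, b, 0⟩) (h2 : (2 : K) ≠ 0) :
    (⟨0, -2 * a, 0, a ^ 2 - 4 * b, 0⟩ : WeierstrassCurve K).IsElliptic := by
  refine ⟨IsUnit.mk0 _ ?_⟩
  have h : V.Δ = 16 * b ^ 2 * (a ^ 2 - 4 * b) := by
    subst hV
    simp only [Δ, b₂, b₄, b₆, b₈]
    ring
  have h' : (⟨0, -2 * a, 0, a ^ 2 - 4 * b, 0⟩ : WeierstrassCurve K).Δ =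
      2 ^ 8 * b * (a ^ 2 - 4 * b) ^ 2 := by
    simp only [Δ, b₂, b₄, b₆, b₈]
    ring
  have h0 := V.isUnit_Δ.ne_zero
  rw [h] at h0
  rw [h']
  exact mul_ne_zero (mul_ne_zero (pow_ne_zero _ h2) (coeff_ne_zero_of_isElliptic hV))
    (pow_ne_zero _ (right_ne_zero_of_mul h0))

lemma eq_zero_of_X_eq_zero (hV : V = ⟨0, a, 0, b, 0⟩) {x y : K} (h : V.toAffine.Nonsingular x y)
    (hx : x = 0) : y = 0 := by
  have := (equation_iff_of_eq hV x y).1 h.1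
  subst hx
  simpa using this

lemma nonsingular_zero_zero [V.IsElliptic] (hV : V = ⟨0, a, 0, b, 0⟩) : V.toAffine.Nonsingular 0 0 :=
  equation_iff_nonsingular.1 ((equation_iff_of_eq hV 0 0).2 (by ring))

variable [V.IsElliptic] [V'.IsElliptic] [DecidableEq K]

/-- Adding (0, 0) sends (x, y) to (b / x, -by / x²), and both coordinates of the isogeny are
invariant under this. -/
lemma twoIsogeny_zero_zero_add (hV : V = ⟨0, a, 0, b, 0⟩)
    (hV' : V' = ⟨0, -2 * a, 0, a ^ 2 - 4 * b, 0⟩) {x y : K} (h : V.toAffine.Nonsingular x y)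
    (hx : x ≠ 0) : twoIsogeny hV hV' (.some 0 0 (nonsingular_zero_zero hV) + .some x y h) =
      twoIsogeny hV hV' (.some x y h) := by
  have hb := coeff_ne_zero_of_isElliptic hV
  have q := (equation_iff_of_eq hV x y).1 h.1
  have hsl : V.toAffine.slope 0 x 0 y = y / x := by
    rw [slope_of_X_ne hx.symm, zero_sub, zero_sub, neg_div_neg_eq]
  have h3 := nonsingular_add (nonsingular_zero_zero hV) h (fun h ↦ hx h.1.symm)
  have hX : V.toAffine.addX 0 x (V.toAffine.slope 0 x 0 y) = b / x := by
    rw [hsl, addX]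
    have : V.a₁ = 0 ∧ V.a₂ = a := by subst hV; exact ⟨rfl, rfl⟩
    rw [this.1, this.2, div_pow, q]
    field_simp
    ring
  have hY : V.toAffine.addY 0 x 0 (V.toAffine.slope 0 x 0 y) = -(y * b / x ^ 2) := by
    rw [addY, negAddY, hX, negY, hsl]
    have : V.a₁ = 0 ∧ V.a₃ = 0 := by subst hV; exact ⟨rfl, rfl⟩
    rw [this.1, this.2]
    field_simp
    ring
  rw [Point.add_of_X_ne hx.symm]
  obtain ⟨h₁', e₁⟩ := twoIsogeny_some hV hV' h hx
  obtain ⟨h₂', e₂⟩ := twoIsogeny_some hV hV' h3 (by rw [hX]; exact div_ne_zero hb hx)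
  rw [e₁, e₂, Point.some.injEq, hX, hY]
  constructor
  · field_simp
  · field_simp
    ring

variable [IsAlgClosed K]

/-- `twoIsogeny` as a group homomorphism. -/
noncomputable def twoIsogenyHom (h2 : (2 : K) ≠ 0) (hV : V = ⟨0, a, 0, b, 0⟩)
    (hV' : V' = ⟨0, -2 * a, 0, a ^ 2 - 4 * b, 0⟩) : V.toAffine.Point →+ V'.toAffine.Point where
  toFun := twoIsogeny hV hV'
  map_zero' := rfl
  map_add' := by
    have := infinite_point (W := V) h2
    have h0 : twoIsogeny hV hV' 0 = 0 := rfl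
    refine map_add_of_generic _ fun P ↦ ?_
    rcases P with _ | ⟨x₁, y₁, h₁⟩
    · refine Set.finite_empty.subset fun Q hQ ↦ hQ ?_
      rw [← Point.zero_def, zero_add, h0, zero_add]
    by_cases hx₁ : x₁ = 0
    · obtain rfl := eq_zero_of_X_eq_zero hV h₁ hx₁
      subst hx₁
      refine (Set.finite_singleton (.some 0 0 h₁)).subset fun Q hQ ↦ ?_
      rcases Q with _ | ⟨x₂, y₂, h₂⟩
      · exact absurd (by rw [← Point.zero_def, add_zero, h0, add_zero]) hQ
      by_cases hx₂ : x₂ = 0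
      · obtain rfl := eq_zero_of_X_eq_zero hV h₂ hx₂
        subst hx₂
        rfl
      · exact absurd (by rw [twoIsogeny_zero_zero_add hV hV' h₂ hx₂,
          twoIsogeny_of_eq_zero hV hV' h₁ rfl, zero_add]) hQ
    · set T : V.toAffine.Point := .some 0 0 (nonsingular_zero_zero hV)
      -- The finitely many Q left out: equal x with P, x = 0, images with equal x (x₁x₂ = b), and P
      -- + Q = T, whose image is 0.
      obtain ⟨s, -, hs⟩ := exists_finset_of_x_mem (W := V) h2 {x₁, 0, b / x₁}
      refine (s.finite_toSet.union (Set.finite_singleton (T - .some x₁ y₁ h₁))).subset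
        fun Q hQ ↦ ?_
      by_contra hQs
      rw [Set.mem_union, not_or] at hQs
      obtain ⟨hQs, hQT⟩ := hQs
      rcases Q with _ | ⟨x₂, y₂, h₂⟩
      · exact hQ (by rw [← Point.zero_def, add_zero, h0, add_zero])
      have hmem : x₂ ∉ ({x₁, 0, b / x₁} : Finset K) := fun hm ↦ hQs (hs _ (by
        rintro x y h e
        obtain ⟨rfl, rfl⟩ := Point.some.inj e
        exact hm))
      simp only [Finset.mem_insert, Finset.mem_singleton, not_or] at hmem
      obtain ⟨e1, e2, e3⟩ := hmem
      refine hQ (twoIsogeny_add_of_ne hV hV' h₁ h₂ (Ne.symm e1) hx₁ e2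
        (fun e ↦ e3 (by rw [← e]; field_simp)) fun hx₃ ↦ hQT ?_)
      have hne : ¬(x₁ = x₂ ∧ y₁ = V.toAffine.negY x₂ y₂) := fun h ↦ e1 h.1.symm
      rw [Set.mem_singleton_iff, eq_sub_iff_add_eq', Point.add_some hne, Point.some.injEq]
      exact ⟨hx₃, eq_zero_of_X_eq_zero hV (nonsingular_add h₁ h₂ hne) hx₃⟩

lemma twoIsogenyHom_eq_zero_iff (h2 : (2 : K) ≠ 0) (hV : V = ⟨0, a, 0, b, 0⟩)
    (hV' : V' = ⟨0, -2 * a, 0, a ^ 2 - 4 * b, 0⟩) (P : V.toAffine.Point) :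
    twoIsogenyHom h2 hV hV' P = 0 ↔ P = 0 ∨ P = .some 0 0 (nonsingular_zero_zero hV) := by
  change twoIsogeny hV hV' P = 0 ↔ _
  rcases P with _ | ⟨x, y, h⟩
  · exact ⟨fun _ ↦ .inl rfl, fun _ ↦ rfl⟩
  by_cases hx : x = 0
  · obtain rfl := eq_zero_of_X_eq_zero hV h hx
    subst hx
    exact ⟨fun _ ↦ .inr rfl, fun _ ↦ twoIsogeny_of_eq_zero hV hV' h rfl⟩
  · obtain ⟨h', e⟩ := twoIsogeny_some hV hV' h hx
    rw [e]
    refine ⟨fun h ↦ absurd h (Point.some_ne_zero _), ?_⟩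
    rintro (h | h)
    · exact absurd h (Point.some_ne_zero _)
    · exact absurd (Point.some.inj h).1 hx

/-- Solving X = x + a + b / x gives x; then y = xv with v a square root of X, its sign being fixed
by v(x - b / x) = Y. -/
lemma twoIsogenyHom_surjective (h2 : (2 : K) ≠ 0) (hV : V = ⟨0, a, 0, b, 0⟩)
    (hV' : V' = ⟨0, -2 * a, 0, a ^ 2 - 4 * b, 0⟩) :
    Function.Surjective (twoIsogenyHom h2 hV hV') := by
  have hb := coeff_ne_zero_of_isElliptic hV
  rintro (_ | ⟨X, Y, H⟩)
  · exact ⟨0, rfl⟩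
  have q := (equation_iff_of_eq hV' X Y).1 H.1
  obtain ⟨d, hd⟩ := IsAlgClosed.exists_eq_mul_self ((a - X) ^ 2 - 4 * b)
  obtain ⟨x, hx⟩ : ∃ x : K, x ^ 2 + (a - X) * x + b = 0 := by
    refine ⟨(X - a + d) / 2, ?_⟩
    field_simp
    linear_combination -hd
  have hx0 : x ≠ 0 := by
    rintro rfl
    exact hb (by linear_combination hx)
  have hX : X = x + a + b / x := by
    field_simp
    linear_combination -hx
  obtain ⟨w, hw⟩ := IsAlgClosed.exists_eq_mul_self X
  obtain ⟨v, hv, hvY⟩ : ∃ v, v * v = X ∧ v * (x - b / x) = Y := by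
    have : (w * (x - b / x) - Y) * (w * (x - b / x) + Y) = 0 := by
      have e : (w * (x - b / x) - Y) * (w * (x - b / x) + Y) =
        X * (x - b / x) ^ 2 - Y ^ 2 := by rw [hw]; ring
      have e' : (x - b / x) ^ 2 = (X - a) ^ 2 - 4 * b := by
        rw [hX]; field_simp; ring
      rw [e, e', q]
      ring
    rcases mul_eq_zero.1 this with h | h
    · exact ⟨w, hw.symm, sub_eq_zero.1 h⟩
    · exact ⟨-w, by rw [hw]; ring, by linear_combination -h⟩
  have hxX : x * X = x ^ 2 + a * x + b := by linear_combination -hx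
  have heq : V.toAffine.Equation x (x * v) := by
    rw [equation_iff_of_eq hV]
    linear_combination x ^ 2 * hv + x * hxX
  obtain ⟨h', e⟩ := twoIsogeny_some hV hV' (equation_iff_nonsingular.1 heq) hx0
  refine ⟨.some x (x * v) (equation_iff_nonsingular.1 heq), e.trans ?_⟩
  rw [Point.some.injEq]
  constructor
  · rw [← hv]; field_simp
  · rw [← hvY]; field_simp

end TwoIsogenyHom

/-! ### Homogeneous formulas over the base field -/

section Morphism

variable {F : Type*} [Field F]

open scoped Classical in
lemma isMorphismOver_translateHom {W W' : WeierstrassCurve F}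
    [(W.baseChange (AlgebraicClosure F)).IsElliptic]
    [(W'.baseChange (AlgebraicClosure F)).IsElliptic] {r s t : F}
    (h2 : (2 : AlgebraicClosure F) ≠ 0)
    (hV : W'.baseChange (AlgebraicClosure F) = (⟨1, algebraMap _ _ r, algebraMap _ _ s,
      algebraMap _ _ t⟩ : VariableChange (AlgebraicClosure F)) •
        W.baseChange (AlgebraicClosure F)) :
    IsMorphismOver W W' (translateHom h2 hV) := by
  have key (Q : GeomPoint W) (i : Fin 3) : homCoords (translateHom h2 hV Q) i =
      MvPolynomial.aeval (homCoords Q) ((![.X 0 - .C r * .X 2,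
        .X 1 - .C s * (.X 0 - .C r * .X 2) - .C t * .X 2, .X 2] :
          Fin 3 → MvPolynomial (Fin 3) F) i) := by
    rcases Q with _ | ⟨x, y, h⟩
    · change homCoords (0 : GeomPoint W') i = _
      fin_cases i <;> simp [homCoords]
    · change homCoords (Point.some _ _ _ : GeomPoint W') i = _
      fin_cases i <;> simp [homCoords]
  have hX (i : Fin 3) := MvPolynomial.isHomogeneous_X F i
  have hCX (c : F) {p : MvPolynomial (Fin 3) F} (hp : p.IsHomogeneous 1) :
      (MvPolynomial.C c * p).IsHomogeneous 1 := hp.C_mul c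
  refine fun P ↦ ⟨1, ![.X 0 - .C r * .X 2,
    .X 1 - .C s * (.X 0 - .C r * .X 2) - .C t * .X 2, .X 2], ?_, ?_, ?_⟩
  · intro i
    fin_cases i
    · exact (hX 0).sub (hCX _ (hX 2))
    · exact ((hX 1).sub (hCX _ ((hX 0).sub (hCX _ (hX 2))))).sub (hCX _ (hX 2))
    · exact hX 2
  · obtain ⟨i, hi⟩ := homCoords_ne_zero (translateHom h2 hV P)
    exact ⟨i, by rwa [← key]⟩
  · exact fun Q _ ↦ ⟨1, one_ne_zero, fun i ↦ by rw [one_mul, key]⟩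

open scoped Classical in
lemma isMorphismOver_twoIsogenyHom {W W' : WeierstrassCurve F}
    [(W.baseChange (AlgebraicClosure F)).IsElliptic]
    [(W'.baseChange (AlgebraicClosure F)).IsElliptic] {a b : F}
    (h2 : (2 : AlgebraicClosure F) ≠ 0)
    (hV : W.baseChange (AlgebraicClosure F) = ⟨0, algebraMap _ _ a, 0, algebraMap _ _ b, 0⟩)
    (hV' : W'.baseChange (AlgebraicClosure F) = ⟨0, -2 * algebraMap _ _ a, 0,
      algebraMap _ _ a ^ 2 - 4 * algebraMap _ _ b, 0⟩) :
    IsMorphismOver W W' (twoIsogenyHom h2 hV hV') := by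
  have hb := coeff_ne_zero_of_isElliptic hV
  have hφ0 : twoIsogenyHom h2 hV hV' 0 = 0 := map_zero _
  have hφ {x y : AlgebraicClosure F} (h) (hx : x ≠ 0) :
      homCoords (twoIsogenyHom h2 hV hV' (.some x y h)) =
        ![y ^ 2 / x ^ 2, y * (x ^ 2 - algebraMap _ _ b) / x ^ 2, 1] := by
    obtain ⟨h', e⟩ := twoIsogeny_some hV hV' h hx
    rw [show twoIsogenyHom h2 hV hV' (.some x y h) = _ from e]
    rfl
  have hφT (h) : homCoords (twoIsogenyHom h2 hV hV' (.some 0 0 h)) = ![0, 1, 0] := by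
    rw [(twoIsogenyHom_eq_zero_iff h2 hV hV' _).2 (.inr rfl)]
    rfl
  have hX (i : Fin 3) := MvPolynomial.isHomogeneous_X F i
  have hCX (c : F) {p : MvPolynomial (Fin 3) F} {n : ℕ} (hp : p.IsHomogeneous n) :
      (MvPolynomial.C c * p).IsHomogeneous n := hp.C_mul c
  intro P
  rcases P with _ | ⟨x₀, y₀, h₀⟩
  -- Near infinity: the naive triple (y²z, y(x² - bz²), x²z) is multiplied by x / z and rewritten
  -- with x³ = z(y² - ax² - bxz).
  · refine ⟨3, ![.X 0 * .X 1 ^ 2,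
      .X 1 * (.X 1 ^ 2 - .C a * .X 0 ^ 2 - .C (b + b) * (.X 0 * .X 2)),
      .X 2 * (.X 1 ^ 2 - .C a * .X 0 ^ 2 - .C b * (.X 0 * .X 2))], ?_, ⟨1, ?_⟩, ?_⟩
    · intro i
      fin_cases i
      · exact (hX 0).mul ((hX 1).pow 2)
      · exact (hX 1).mul ((((hX 1).pow 2).sub (hCX _ ((hX 0).pow 2))).sub
          (hCX _ ((hX 0).mul (hX 2))))
      · exact (hX 2).mul ((((hX 1).pow 2).sub (hCX _ ((hX 0).pow 2))).sub
          (hCX _ ((hX 0).mul (hX 2))))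
    · simp [homCoords]
    · rintro (_ | ⟨x, y, h⟩) hne
      · refine ⟨1, one_ne_zero, fun i ↦ ?_⟩
        rw [← Point.zero_def, hφ0]
        fin_cases i <;> simp [homCoords]
      have q := (equation_iff_of_eq hV x y).1 h.1
      by_cases hx : x = 0
      · obtain rfl := eq_zero_of_X_eq_zero hV h hx
        subst hx
        obtain ⟨i, hi⟩ := hne
        fin_cases i <;> simp [homCoords] at hi
      · refine ⟨(x ^ 3)⁻¹, inv_ne_zero (pow_ne_zero _ hx), fun i ↦ ?_⟩
        rw [hφ h hx]
        fin_cases i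
        · simp [homCoords]
          field_simp
        · simp [homCoords]
          field_simp
          linear_combination (-y) * q
        · simp [homCoords]
          field_simp
          linear_combination -q
  by_cases hx₀ : x₀ = 0
  · obtain rfl := eq_zero_of_X_eq_zero hV h₀ hx₀
    subst hx₀
    -- Near (0, 0): the naive triple is multiplied by yz / x and rewritten with y²z = x(x² + axz +
    -- bz²); at (0, 0) the middle entry is -b² ≠ 0.
    refine ⟨4, ![.X 1 * .X 2 * (.X 0 ^ 2 + .C a * (.X 0 * .X 2) + .C b * .X 2 ^ 2),
      (.X 0 ^ 2 - .C b * .X 2 ^ 2) * (.X 0 ^ 2 + .C a * (.X 0 * .X 2) + .C b * .X 2 ^ 2),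
      .X 0 * .X 1 * .X 2 ^ 2], ?_, ⟨1, ?_⟩, ?_⟩
    · have hq := (((hX 0).pow 2).add (hCX a ((hX 0).mul (hX 2)))).add (hCX b ((hX 2).pow 2))
      intro i
      fin_cases i
      · exact ((hX 1).mul (hX 2)).mul hq
      · exact (((hX 0).pow 2).sub (hCX b ((hX 2).pow 2))).mul hq
      · exact ((hX 0).mul (hX 1)).mul ((hX 2).pow 2)
    · simpa [homCoords] using hb
    · rintro (_ | ⟨x, y, h⟩) hne
      · obtain ⟨i, hi⟩ := hne
        fin_cases i <;> simp [homCoords] at hi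
      have q := (equation_iff_of_eq hV x y).1 h.1
      by_cases hx : x = 0
      · obtain rfl := eq_zero_of_X_eq_zero hV h hx
        subst hx
        refine ⟨-(algebraMap F (AlgebraicClosure F) b ^ 2)⁻¹,
          neg_ne_zero.2 (inv_ne_zero (pow_ne_zero _ hb)), fun i ↦ ?_⟩
        rw [hφT]
        fin_cases i <;> simp [homCoords]
        field_simp
      · have q' : x * (x ^ 2 + algebraMap _ _ a * x + algebraMap _ _ b) = y ^ 2 := by
          linear_combination -q
        by_cases hy : y = 0
        · subst hy
          have q0 : x ^ 2 + algebraMap _ _ a * x + algebraMap _ _ b = 0 := by simpa [hx] using q'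
          obtain ⟨i, hi⟩ := hne
          fin_cases i <;> simp [homCoords, q0] at hi
        · refine ⟨(x * y)⁻¹, inv_ne_zero (mul_ne_zero hx hy), fun i ↦ ?_⟩
          rw [hφ h hx]
          fin_cases i
          · simp [homCoords]
            field_simp
            linear_combination q
          · simp [homCoords]
            field_simp
            linear_combination (x ^ 2 - algebraMap _ _ b) * q
          · simp [homCoords]
            field_simp
  -- Elsewhere the naive triple suffices.
  · refine ⟨3, ![.X 1 ^ 2 * .X 2, .X 1 * (.X 0 ^ 2 - .C b * .X 2 ^ 2), .X 0 ^ 2 * .X 2],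
      ?_, ⟨2, ?_⟩, ?_⟩
    · intro i
      fin_cases i
      · exact ((hX 1).pow 2).mul (hX 2)
      · exact (hX 1).mul (((hX 0).pow 2).sub (hCX b ((hX 2).pow 2)))
      · exact ((hX 0).pow 2).mul (hX 2)
    · simpa [homCoords] using hx₀
    · rintro (_ | ⟨x, y, h⟩) hne
      · obtain ⟨i, hi⟩ := hne
        fin_cases i <;> simp [homCoords] at hi
      by_cases hx : x = 0
      · obtain rfl := eq_zero_of_X_eq_zero hV h hx
        subst hx
        obtain ⟨i, hi⟩ := hne
        fin_cases i <;> simp [homCoords] at hi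
      · refine ⟨(x ^ 2)⁻¹, inv_ne_zero (pow_ne_zero _ hx), fun i ↦ ?_⟩
        rw [hφ h hx]
        fin_cases i
        · simp [homCoords]
          field_simp
        · simp [homCoords]
          field_simp
        · simp [homCoords]
          field_simp

end Morphism

/-! ### Quotient by a rational point of order two -/

section Quotient

variable {F : Type*} [Field F] [Fintype F]

open scoped Classical in
/-- The quotient of an elliptic curve by a rational subgroup of order two. -/
lemma exists_isIsogeny_of_two_torsion (hF : ringChar F ≠ 2) (W : WeierstrassCurve F)
    [W.IsElliptic] {T : GeomPoint W} (hT0 : T ≠ 0) (hT : T + T = 0)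
    (hfr : frob W (AlgebraicClosure F) T = T) :
    ∃ (W' : WeierstrassCurve F) (_ : W'.IsElliptic) (φ : GeomPoint W →+ GeomPoint W'),
      IsIsogeny W W' φ ∧ ∀ P, φ P = 0 ↔ P = 0 ∨ P = T := by
  have h2 : (2 : AlgebraicClosure F) ≠ 0 := algebra_two_ne_zero (F := F) _ hF
  have h2' : (2 : F) ≠ 0 := algebra_two_ne_zero (F := F) _ hF
  have hell (V : WeierstrassCurve F) [V.IsElliptic] :
      (V.baseChange (AlgebraicClosure F)).IsElliptic := inferInstanceAs (V.map _).IsElliptic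
  have := hell W
  rcases T with _ | ⟨x, y, h⟩
  · exact absurd rfl hT0
  obtain ⟨h', e⟩ := frob_some h
  rw [e, Point.some.injEq] at hfr
  obtain ⟨r, rfl⟩ := mem_range_algebraMap_iff.2 hfr.1
  obtain ⟨t, rfl⟩ := mem_range_algebraMap_iff.2 hfr.2
  have hinj := (algebraMap F (AlgebraicClosure F)).injective
  have hm (n : ℕ) [n.AtLeastTwo] := map_ofNat (algebraMap F (AlgebraicClosure F)) n
  have heq : W.toAffine.Equation r t := (Affine.map_equation W.toAffine hinj r t).1 h.1
  have ht : 2 * t + W.a₁ * r + W.a₃ = 0 := by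
    refine hinj ?_
    simpa [hm] using (add_self_eq_zero_iff h).1 hT
  -- T = (r, t) moves to the origin: s = -a₁/2 removes a₁, the 2-torsion relation removes a₃, and
  -- the curve equation at T removes a₆.
  set C : VariableChange F := ⟨1, r, -(W.a₁ / 2), t⟩ with hC
  have hW₁ : (C • W).IsElliptic := inferInstance
  have hform : C • W = ⟨0, (C • W).a₂, 0, (C • W).a₄, 0⟩ := by
    rw [equation_iff'] at heq
    ext
    · simp [variableChange_a₁, C]; field_simp; ring
    · rfl
    · simp [variableChange_a₃, C]; linear_combination ht
    · rfl
    · simp [variableChange_a₆, C]; linear_combination -heq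
  set a := (C • W).a₂
  set b := (C • W).a₄
  have hell' := isElliptic_twoIsogeny hform h2'
  set W' : WeierstrassCurve F := ⟨0, -2 * a, 0, a ^ 2 - 4 * b, 0⟩ with hW'
  have := hell (C • W)
  have := hell W'
  have hV : (C • W).baseChange (AlgebraicClosure F) =
      (⟨1, algebraMap _ _ r, algebraMap _ _ (-(W.a₁ / 2)), algebraMap _ _ t⟩ :
        VariableChange (AlgebraicClosure F)) • W.baseChange (AlgebraicClosure F) := by
    rw [WeierstrassCurve.baseChange, ← map_variableChange]
    congr 1
  have hV1 : (C • W).baseChange (AlgebraicClosure F) =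
      ⟨0, algebraMap _ _ a, 0, algebraMap _ _ b, 0⟩ := by
    rw [hform]
    ext <;> simp
  have hV2 : W'.baseChange (AlgebraicClosure F) = ⟨0, -2 * algebraMap _ _ a, 0,
      algebraMap _ _ a ^ 2 - 4 * algebraMap _ _ b, 0⟩ := by
    ext <;> simp [W', hm]
  have hbij := translateHom_bijective h2 hV
  refine ⟨W', hell', (twoIsogenyHom h2 hV1 hV2).comp (translateHom h2 hV), IsIsogeny.comp
    ⟨isMorphismOver_twoIsogenyHom h2 hV1 hV2, twoIsogenyHom_surjective h2 hV1 hV2, ?_⟩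
    ⟨isMorphismOver_translateHom h2 hV, hbij.2, ?_⟩, fun P ↦ ?_⟩
  · refine (Set.toFinite {0, .some 0 0 (nonsingular_zero_zero hV1)}).subset fun P hP ↦ ?_
    exact (twoIsogenyHom_eq_zero_iff h2 hV1 hV2 P).1 hP
  · rw [(AddMonoidHom.ker_eq_bot_iff _).2 hbij.1]
    exact Set.finite_singleton _
  · have hTim : translateHom h2 hV (.some _ _ h) = .some 0 0 (nonsingular_zero_zero hV1) := by
      refine (Point.some.injEq ..).mpr ⟨?_, ?_⟩ <;> ring
    rw [AddMonoidHom.comp_apply, twoIsogenyHom_eq_zero_iff, ← hTim, hbij.1.eq_iff,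
      map_eq_zero_iff _ hbij.1]

end Quotient

/-! ### Rational 2-torsion as Frobenius invariants -/

section RationalTorsion

variable {F : Type*} [Field F]

open scoped Classical in
lemma ncard_geom_two_torsion [Fintype F] (hF : ringChar F ≠ 2) (W : WeierstrassCurve F) [W.IsElliptic] :
    {P : GeomPoint W | P + P = 0}.ncard = 4 := by
  have : (W.baseChange (AlgebraicClosure F)).IsElliptic := inferInstanceAs (W.map _).IsElliptic
  exact card_two_torsion (algebra_two_ne_zero (F := F) _ hF)

variable [DecidableEq F]

open scoped Classical in
/-- The inclusion of the rational points into the geometric points. -/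
noncomputable def toGeomPoint (W : WeierstrassCurve F) : W.toAffine.Point →+ GeomPoint W :=
  Point.map (W' := W.toAffine) (F := F) (Algebra.ofId F (AlgebraicClosure F))

lemma toGeomPoint_injective (W : WeierstrassCurve F) : Function.Injective (toGeomPoint W) := by
  classical
  exact Point.map_injective (W' := W.toAffine) (F := F) (Algebra.ofId F (AlgebraicClosure F))

lemma mem_ratTwoTorsion_iff {W : WeierstrassCurve F} {R : W.toAffine.Point} :
    R ∈ ratTwoTorsion W ↔ R + R = 0 := by
  change (2 : ℤ) • R = 0 ↔ _
  rw [two_zsmul]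

variable [Fintype F]

open scoped Classical in
lemma frob_eq_self_iff {W : WeierstrassCurve F} {P : GeomPoint W} :
    frob W (AlgebraicClosure F) P = P ↔ ∃ R, toGeomPoint W R = P := by
  constructor
  · rcases P with _ | ⟨x, y, h⟩
    · exact fun _ ↦ ⟨0, rfl⟩
    · intro hfr
      obtain ⟨h', e⟩ := frob_some h
      rw [e, Point.some.injEq] at hfr
      obtain ⟨r, rfl⟩ := mem_range_algebraMap_iff.2 hfr.1
      obtain ⟨t, rfl⟩ := mem_range_algebraMap_iff.2 hfr.2
      exact ⟨.some r t ((Affine.map_nonsingular W.toAffine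
        (algebraMap F (AlgebraicClosure F)).injective r t).1 h), rfl⟩
  · rintro ⟨_ | ⟨x, y, h⟩, rfl⟩
    · rfl
    · have hx (z : F) : algebraMap F (AlgebraicClosure F) z ^ Fintype.card F = algebraMap F _ z := by
        rw [← map_pow, FiniteField.pow_card]
      exact (Point.some.injEq ..).mpr ⟨hx x, hx y⟩

open scoped Classical in
/-- All geometric 2-torsion points are fixed by the Frobenius. -/
def IsFull (W : WeierstrassCurve F) : Prop :=
  ∀ P : GeomPoint W, P + P = 0 → frob W (AlgebraicClosure F) P = P

open scoped Classical in
/-- There is a nonzero 2-torsion point fixed by the Frobenius. -/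
def HasRatTwoTorsion (W : WeierstrassCurve F) : Prop :=
  ∃ T : GeomPoint W, T ≠ 0 ∧ T + T = 0 ∧ frob W (AlgebraicClosure F) T = T

open scoped Classical in
lemma card_ratTwoTorsion (W : WeierstrassCurve F) : Nat.card (ratTwoTorsion W) =
    {P : GeomPoint W | P + P = 0 ∧ frob W (AlgebraicClosure F) P = P}.ncard := by
  rw [← SetLike.coe_sort_coe, Nat.card_coe_set_eq,
    ← Set.ncard_image_of_injective _ (toGeomPoint_injective W)]
  congr 1
  ext P
  simp only [Set.mem_image, SetLike.mem_coe, mem_ratTwoTorsion_iff, Set.mem_ofPred_eq,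
    frob_eq_self_iff]
  constructor
  · rintro ⟨R, hR, rfl⟩
    exact ⟨by rw [← map_add, hR, map_zero], R, rfl⟩
  · rintro ⟨hP, R, rfl⟩
    exact ⟨R, toGeomPoint_injective W (by rw [map_add, hP, map_zero]), rfl⟩

lemma IsFull.nonempty_addEquiv (hF : ringChar F ≠ 2) {W : WeierstrassCurve F} [W.IsElliptic]
    (h : IsFull W) : Nonempty (ratTwoTorsion W ≃+ ZMod 2 × ZMod 2) := by
  classical
  have hc : Nat.card (ratTwoTorsion W) = 4 := by
    rw [card_ratTwoTorsion, ← ncard_geom_two_torsion hF W]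
    congr 1
    ext P
    exact ⟨fun hP ↦ hP.1, fun hP ↦ ⟨hP, h P hP⟩⟩
  have : IsAddKleinFour (ratTwoTorsion W) := ⟨hc, by
    refine ((Nat.dvd_prime Nat.prime_two).1 ?_).resolve_left fun h1 ↦ ?_
    · refine AddMonoid.exponent_dvd_of_forall_nsmul_eq_zero fun R ↦ Subtype.ext ?_
      rw [two_nsmul]
      exact mem_ratTwoTorsion_iff.1 R.2
    · have := AddMonoid.exp_eq_one_iff.1 h1
      rw [Nat.card_of_subsingleton 0] at hc
      norm_num at hc⟩
  exact IsAddKleinFour.nonempty_addEquiv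

lemma HasRatTwoTorsion.nonempty_addEquiv (hF : ringChar F ≠ 2) {W : WeierstrassCurve F}
    [W.IsElliptic] (h : HasRatTwoTorsion W) (h' : ¬ IsFull W) :
    Nonempty (ratTwoTorsion W ≃+ ZMod 2) := by
  classical
  obtain ⟨T, hT0, hT, hfT⟩ := h
  obtain ⟨V, hV, hfV⟩ : ∃ V : GeomPoint W, V + V = 0 ∧ frob W (AlgebraicClosure F) V ≠ V := by
    simpa [IsFull] using h'
  have h4 := ncard_geom_two_torsion hF W
  have hfin : {P : GeomPoint W | P + P = 0}.Finite :=
    Set.finite_of_ncard_ne_zero (by rw [h4]; norm_num)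
  have hfin' : {P : GeomPoint W | P + P = 0 ∧ frob W (AlgebraicClosure F) P = P}.Finite :=
    hfin.subset fun P hP ↦ hP.1
  have hc : Nat.card (ratTwoTorsion W) = 2 := by
    rw [card_ratTwoTorsion]
    refine le_antisymm ?_ ?_
    -- The translate of the fixed 2-torsion by a moved point V is disjoint from it, and both lie in
    -- a set of four elements.
    · have hd : Disjoint {P : GeomPoint W | P + P = 0 ∧ frob W (AlgebraicClosure F) P = P}
          ((fun P ↦ P + V) '' {P : GeomPoint W | P + P = 0 ∧ frob W (AlgebraicClosure F) P = P}) := by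
        rw [Set.disjoint_left]
        rintro _ ⟨-, hP⟩ ⟨Q, ⟨-, hQ⟩, rfl⟩
        rw [map_add, hQ] at hP
        exact hfV (add_left_cancel hP)
      have hle := Set.ncard_le_ncard (s := {P : GeomPoint W | P + P = 0 ∧
          frob W (AlgebraicClosure F) P = P} ∪
        ((fun P ↦ P + V) '' {P : GeomPoint W | P + P = 0 ∧ frob W (AlgebraicClosure F) P = P}))
        (t := {P : GeomPoint W | P + P = 0}) (by
          rintro P (hP | ⟨Q, hQ, rfl⟩)
          · exact hP.1
          · change Q + V + (Q + V) = 0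
            rw [add_add_add_comm, hQ.1, hV, add_zero]) hfin
      rw [Set.ncard_union_eq hd hfin' (hfin'.image _),
        Set.ncard_image_of_injective _ (add_left_injective V), h4] at hle
      omega
    · rw [← Set.ncard_pair hT0.symm]
      refine Set.ncard_le_ncard ?_ hfin'
      rintro P (rfl | rfl)
      · exact ⟨add_zero 0, map_zero _⟩
      · exact ⟨hT, hfT⟩
  exact ⟨addEquivOfPrimeCardEq (p := 2) hc (by simp)⟩

end RationalTorsion

/-! ### More on groups with small 2-torsion -/

section GroupTheory

variable {A : Type*} [AddCommGroup A]

lemma eq_or_eq_of_ncard_two_torsion (h4 : {P : A | P + P = 0}.ncard = 4) {T V : A} (hT0 : T ≠ 0)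
    (hT : T + T = 0) (hV0 : V ≠ 0) (hV : V + V = 0) (hVT : V ≠ T) {P : A} (hP : P + P = 0) :
    P = 0 ∨ P = T ∨ P = V ∨ P = V + T := by
  classical
  have hfin : {P : A | P + P = 0}.Finite := Set.finite_of_ncard_ne_zero (by rw [h4]; norm_num)
  have hsub : (({0, T, V, V + T} : Finset A) : Set A) ⊆ {P : A | P + P = 0} := by
    intro Q hQ
    simp only [Finset.coe_insert, Finset.coe_singleton, Set.mem_insert_iff,
      Set.mem_singleton_iff] at hQ
    rcases hQ with rfl | rfl | rfl | rfl
    · exact add_zero 0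
    · exact hT
    · exact hV
    · change V + T + (V + T) = 0
      rw [add_add_add_comm, hV, hT, add_zero]
  have hVT0 : V + T ≠ 0 := fun h ↦ hVT (by
    rw [eq_neg_of_add_eq_zero_left h, ← eq_neg_of_add_eq_zero_left hT])
  have hcard : ({0, T, V, V + T} : Finset A).card = 4 := by
    rw [Finset.card_insert_of_notMem, Finset.card_insert_of_notMem, Finset.card_pair]
    · exact fun h ↦ hT0 (left_eq_add.1 h)
    · simp only [Finset.mem_insert, Finset.mem_singleton, not_or]
      exact ⟨hVT.symm, fun h ↦ hV0 (right_eq_add.1 h)⟩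
    · simp only [Finset.mem_insert, Finset.mem_singleton, not_or]
      exact ⟨hT0.symm, hV0.symm, hVT0.symm⟩
  have := Set.eq_of_subset_of_ncard_le hsub (by rw [h4, Set.ncard_coe_finset, hcard]) hfin
  have hP' : P ∈ (({0, T, V, V + T} : Finset A) : Set A) := by rw [this]; exact hP
  simpa using hP'

/-- The kernel of doubling has order dividing 2, so its image has even order and contains an element
of order two, which can only be T. -/
lemma exists_add_self_eq_of_four_dvd_card [Finite A] (h : 4 ∣ Nat.card A) {T : A} (hT0 : T ≠ 0)
    (hT : ∀ S : A, S + S = 0 → S = 0 ∨ S = T) : ∃ R, R + R = T := by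
  have := Fact.mk Nat.prime_two
  set d : A →+ A := nsmulAddMonoidHom 2
  have hk : Nat.card d.ker ∣ 2 := by
    have hle : Nat.card d.ker ≤ 2 := by
      have := Set.ncard_le_ncard (s := (d.ker : Set A)) (t := {0, T})
        (fun S hS ↦ hT S (by rw [← two_nsmul]; exact hS)) (Set.toFinite _)
      rwa [Set.ncard_pair hT0.symm] at this
    have hpos : 0 < Nat.card d.ker := Nat.card_pos
    interval_cases Nat.card d.ker <;> decide
  have hr : 2 ∣ Nat.card d.range := by
    have e : Nat.card A = Nat.card d.range * Nat.card d.ker := by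
      rw [← AddSubgroup.card_mul_index d.ker, AddSubgroup.index_ker, mul_comm]
    obtain ⟨m, hm⟩ := hk
    refine Nat.dvd_of_mul_dvd_mul_left (k := 2) (by norm_num) ?_
    rw [e] at h
    calc 2 * 2 ∣ Nat.card d.range * Nat.card d.ker := h
      _ ∣ 2 * Nat.card d.range := by
        rw [mul_comm]; exact Nat.mul_dvd_mul_right ⟨m, hm⟩ _
  obtain ⟨S, hS⟩ := exists_prime_addOrderOf_dvd_card' 2 hr
  have hS0 : (S : A) ≠ 0 := fun h0 ↦ by
    rw [(Subtype.ext h0 : S = 0), addOrderOf_zero] at hS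
    norm_num at hS
  have hS2 : (S : A) + S = 0 := by
    have := addOrderOf_nsmul_eq_zero S
    rw [hS, two_nsmul] at this
    exact congrArg Subtype.val this
  obtain ⟨R, hR⟩ := S.2
  refine ⟨R, ?_⟩
  rw [← (hT _ hS2).resolve_left hS0, ← hR, ← two_nsmul]
  rfl

end GroupTheory

/-! ### Full and non-full curves in the isogeny class -/

section Existence

variable {F : Type*} [Field F] [Fintype F] [DecidableEq F]

omit [Fintype F] [DecidableEq F] in
lemma finite_point [Finite F] (W : WeierstrassCurve F) : Finite W.toAffine.Point := by
  refine Finite.of_injective (fun P : W.toAffine.Point ↦ match P with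
    | .zero => none
    | .some x y _ => some (x, y)) ?_
  rintro (_ | ⟨x, y, h⟩) (_ | ⟨x', y', h'⟩) e <;> simp_all

lemma hasRatTwoTorsion_of_two_dvd_card {W : WeierstrassCurve F}
    (h : 2 ∣ Nat.card W.toAffine.Point) : HasRatTwoTorsion W := by
  classical
  have := Fact.mk Nat.prime_two
  have := finite_point W
  obtain ⟨S, hS⟩ := exists_prime_addOrderOf_dvd_card' 2 h
  refine ⟨toGeomPoint W S, fun h0 ↦ ?_, ?_, frob_eq_self_iff.2 ⟨S, rfl⟩⟩
  · rw [map_eq_zero_iff _ (toGeomPoint_injective W)] at h0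
    rw [h0, addOrderOf_zero] at hS
    norm_num at hS
  · rw [← map_add, ← two_nsmul, ← hS, addOrderOf_nsmul_eq_zero, map_zero]

lemma exists_isogenous_isFull (hF : ringChar F ≠ 2) (W : WeierstrassCurve F) [W.IsElliptic]
    (h : 4 ∣ Nat.card W.toAffine.Point) :
    ∃ W' : WeierstrassCurve F, W'.IsElliptic ∧ Isogenous W W' ∧ IsFull W' := by
  classical
  by_cases hfull : IsFull W
  · exact ⟨W, inferInstance, Isogenous.refl W, hfull⟩
  obtain ⟨T, hT0, hT, hfT⟩ := hasRatTwoTorsion_of_two_dvd_card (dvd_trans (by norm_num) h)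
  obtain ⟨V, hV, hfV⟩ : ∃ V : GeomPoint W, V + V = 0 ∧ frob W (AlgebraicClosure F) V ≠ V := by
    simpa [IsFull] using hfull
  have h4 := ncard_geom_two_torsion hF W
  have hV0 : V ≠ 0 := by rintro rfl; exact hfV (map_zero _)
  have hVT : V ≠ T := by rintro rfl; exact hfV hfT
  have hVfrob : frob W (AlgebraicClosure F) V = V + T := by
    rcases eq_or_eq_of_ncard_two_torsion h4 hT0 hT hV0 hV hVT
      (P := frob W (AlgebraicClosure F) V) (by rw [← map_add, hV, map_zero]) with e | e | e | e
    · exact absurd ((map_eq_zero_iff _ frob_injective).1 e) hV0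
    · exact absurd (frob_injective (e.trans hfT.symm)) hVT
    · exact absurd e hfV
    · exact e
  have hsub (P : GeomPoint W) (hP : P + P = 0) :
      frob W (AlgebraicClosure F) P - P = 0 ∨ frob W (AlgebraicClosure F) P - P = T := by
    rcases eq_or_eq_of_ncard_two_torsion h4 hT0 hT hV0 hV hVT hP with rfl | rfl | rfl | rfl
    · left; rw [map_zero, sub_zero]
    · left; rw [hfT, sub_self]
    · right; rw [hVfrob, add_sub_cancel_left]
    · right; rw [map_add, hVfrob, hfT, add_sub_cancel_left]
  obtain ⟨T₀, hT₀⟩ := frob_eq_self_iff.1 hfT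
  have hinj := toGeomPoint_injective W
  have := finite_point W
  obtain ⟨R₀, hR₀⟩ := exists_add_self_eq_of_four_dvd_card h (T := T₀)
    (fun h0 ↦ hT0 (by rw [← hT₀, h0, map_zero])) fun S hS ↦ by
      have hS' : toGeomPoint W S + toGeomPoint W S = 0 := by rw [← map_add, hS, map_zero]
      have hfS : frob W (AlgebraicClosure F) (toGeomPoint W S) = toGeomPoint W S :=
        frob_eq_self_iff.2 ⟨S, rfl⟩
      rcases eq_or_eq_of_ncard_two_torsion h4 hT0 hT hV0 hV hVT hS' with e | e | e | e
      · exact .inl ((map_eq_zero_iff _ hinj).1 e)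
      · exact .inr (hinj (e.trans hT₀.symm))
      · exact absurd (e ▸ hfS) hfV
      · rw [e, map_add, hfT] at hfS
        exact absurd (add_right_cancel hfS) hfV
  set R := toGeomPoint W R₀
  have hR : R + R = T := by rw [← hT₀, ← hR₀, map_add]
  have hfR : frob W (AlgebraicClosure F) R = R := frob_eq_self_iff.2 ⟨R₀, rfl⟩
  obtain ⟨W', hell, φ, hφ, hker⟩ := exists_isIsogeny_of_two_torsion hF W hT0 hT hfT
  refine ⟨W', hell, ⟨φ, hφ⟩, fun U hU ↦ ?_⟩
  obtain ⟨Q, rfl⟩ := hφ.surjective U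
  rw [← hφ.isMorphismOver.frob_comm, ← sub_eq_zero, ← map_sub, hker]
  rw [← map_add, hker] at hU
  rcases hU with hU | hU
  · exact hsub Q hU
  · have e : frob W (AlgebraicClosure F) Q - Q =
        frob W (AlgebraicClosure F) (Q - R) - (Q - R) := by
      rw [map_sub, hfR, sub_sub_sub_cancel_right]
    rw [e]
    exact hsub _ (by rw [sub_add_sub_comm, hU, hR, sub_self])

omit [DecidableEq F] in
open scoped Classical in
-- The induction on k runs over all curves at once: P is pushed to the quotient by T = 2^k P, where
-- its order drops. The scalar j found there is right up to an element of {0, T}, and T is itself a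
-- multiple of P.
lemma frob_mem_zmultiples_of_forall_isFull (hF : ringChar F ≠ 2) (k : ℕ) :
    ∀ (W : WeierstrassCurve F) [W.IsElliptic], HasRatTwoTorsion W →
    (∀ W' : WeierstrassCurve F, W'.IsElliptic → Isogenous W W' → HasRatTwoTorsion W' → IsFull W') →
    ∀ P : GeomPoint W, 2 ^ k • P = 0 → ∃ j : ℤ, frob W (AlgebraicClosure F) P = j • P := by
  induction k with
  | zero => exact fun W _ _ _ P hP ↦ ⟨0, by rw [pow_zero, one_smul] at hP; simp [hP]⟩
  | succ k ih =>
    intro W _ hrat hall P hP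
    by_cases hT0 : 2 ^ k • P = 0
    · exact ih W hrat hall P hT0
    have hfull := hall W inferInstance (Isogenous.refl W) hrat
    set T := 2 ^ k • P with hTP
    have hT : T + T = 0 := by rw [← two_nsmul, hTP, smul_smul, ← pow_succ', hP]
    obtain ⟨W', hell, φ, hφ, hker⟩ := exists_isIsogeny_of_two_torsion hF W hT0 hT (hfull T hT)
    -- A 2-torsion point V outside {0, T} is fixed by π because W is full, and its image is a
    -- nonzero rational 2-torsion point of the quotient.
    have hrat' : HasRatTwoTorsion W' := by
      have h4 := ncard_geom_two_torsion hF W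
      obtain ⟨V, hV, hVT⟩ := Set.exists_mem_notMem_of_ncard_lt_ncard
        (s := {0, T}) (t := {P : GeomPoint W | P + P = 0}) (by
          rw [h4, Set.ncard_pair (Ne.symm hT0)]; norm_num)
      refine ⟨φ V, fun h0 ↦ hVT ((hker V).1 h0), ?_, ?_⟩
      · rw [← map_add, show V + V = 0 from hV, map_zero]
      · rw [← hφ.isMorphismOver.frob_comm, hfull V hV]
    obtain ⟨j, hj⟩ := ih W' hrat' (fun W'' h h' ↦ hall W'' h (Isogenous.trans ⟨φ, hφ⟩ h')) (φ P) (by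
      rw [← map_nsmul, ← hTP, hker]
      exact .inr rfl)
    rw [← hφ.isMorphismOver.frob_comm, ← map_zsmul, ← sub_eq_zero, ← map_sub, hker] at hj
    rcases hj with hj | hj
    · exact ⟨j, sub_eq_zero.1 hj⟩
    · refine ⟨j + 2 ^ k, ?_⟩
      have e : (2 ^ k : ℤ) • P = T := by rw [hTP, ← natCast_zsmul]; norm_cast
      rw [add_zsmul, e, ← hj, add_sub_cancel]

omit [DecidableEq F] in
lemma exists_isogenous_not_isFull (hF : ringChar F ≠ 2) (W : WeierstrassCurve F) [W.IsElliptic]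
    (h : HasRatTwoTorsion W) (hne : frobeniusTrace W ^ 2 ≠ 4 * Fintype.card F) :
    ∃ W' : WeierstrassCurve F, W'.IsElliptic ∧ Isogenous W W' ∧ HasRatTwoTorsion W' ∧
      ¬ IsFull W' := by
  classical
  by_contra! hall
  have hell : (W.baseChange (AlgebraicClosure F)).IsElliptic :=
    inferInstanceAs (W.map _).IsElliptic
  have h2 : (2 : AlgebraicClosure F) ≠ 0 := algebra_two_ne_zero (F := F) _ hF
  set a := frobeniusTrace W
  -- With N = 2^k and 2|s| ≤ N, the kernel bound yields N² ≤ N²/2 + |a|N + 4q + 1, that is N² ≤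
  -- 2|a|N + 8q + 2; this fails once N > 2|a| + 8q + 2.
  obtain ⟨k, hk⟩ : ∃ k : ℕ, 2 * |a| + 8 * Fintype.card F + 2 < (2 : ℤ) ^ k := by
    refine ⟨(2 * |a| + 8 * Fintype.card F + 2).toNat, ?_⟩
    have := Nat.lt_two_pow_self (n := (2 * |a| + 8 * Fintype.card F + 2).toNat)
    zify at this
    rwa [Int.toNat_of_nonneg (by positivity)] at this
  obtain ⟨s₀, hs₀⟩ := exists_zsmul_eq_of_forall_mem_zmultiples (frob W (AlgebraicClosure F))
    (fun k ↦ frob_mem_zmultiples_of_forall_isFull hF k W h hall) k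
  -- The scalar only matters modulo 2^k, so the residue of least absolute value is taken.
  obtain ⟨s, hs, hsN⟩ : ∃ s : ℤ, (∀ P : GeomPoint W, 2 ^ k • P = 0 →
      frob W (AlgebraicClosure F) P = s • P) ∧ 2 * |s| ≤ 2 ^ k := by
    have hN : (0 : ℤ) < 2 ^ k := by positivity
    have key (m : ℤ) (P : GeomPoint W) (hP : 2 ^ k • P = 0) :
        frob W (AlgebraicClosure F) P = (s₀ - 2 ^ k * m) • P := by
      have e : (2 ^ k : ℤ) • P = 0 := by rw [← hP, ← natCast_zsmul]; norm_cast
      rw [sub_zsmul, mul_zsmul', e, zsmul_zero, neg_zero, add_zero, hs₀ P hP]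
    have h1 := Int.emod_add_mul_ediv s₀ (2 ^ k)
    have h3 := Int.emod_nonneg s₀ hN.ne'
    have h4 := Int.emod_lt_of_pos s₀ hN
    rcases le_total (2 * (s₀ % 2 ^ k)) (2 ^ k) with h5 | h5
    · exact ⟨_, key (s₀ / 2 ^ k), by
        rw [show s₀ - 2 ^ k * (s₀ / 2 ^ k) = s₀ % 2 ^ k by linarith, abs_of_nonneg h3]
        exact h5⟩
    · exact ⟨_, key (s₀ / 2 ^ k + 1), by
        rw [show s₀ - 2 ^ k * (s₀ / 2 ^ k + 1) = s₀ % 2 ^ k - 2 ^ k by linarith,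
          abs_of_nonpos (by linarith)]
        linarith⟩
  obtain ⟨t, ht, htm⟩ := exists_finset_two_pow_torsion
    (fun P : GeomPoint W ↦ exists_add_self_eq h2 P) (ncard_geom_two_torsion hF W) k
  obtain ⟨hfin, hle⟩ := ncard_ker_frob_add_le W (AlgebraicClosure F) hF hne (-s)
  have hle' := Set.ncard_le_ncard (s := (t : Set (GeomPoint W))) (fun P hP ↦ by
    change frob W (AlgebraicClosure F) P + -s • P = 0
    rw [hs P (htm P hP), neg_smul, add_neg_cancel]) hfin
  rw [Set.ncard_coe_finset, ht] at hle'
  zify at hle'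
  have e : (4 : ℤ) ^ k = (2 ^ k) ^ 2 := by rw [← pow_mul, mul_comm, pow_mul]; norm_num
  rw [e] at hle'
  have hfinal := hle'.trans hle
  generalize (2 : ℤ) ^ k = N at *
  have h1 : a * -s ≤ |a| * |s| := by rw [← abs_neg s, ← abs_mul]; exact le_abs_self _
  have h3 : (-s) ^ 2 = |s| ^ 2 := by rw [neg_sq, sq_abs]
  rw [h3] at hfinal
  have ha := abs_nonneg a
  have hs0 := abs_nonneg s
  have hq : (0 : ℤ) ≤ Fintype.card F := by positivity
  generalize |s| = u at *
  generalize |a| = v at *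
  nlinarith [mul_nonneg ha (sub_nonneg.2 hsN), mul_nonneg hs0 (sub_nonneg.2 hsN)]

omit [DecidableEq F] in
open scoped Classical in
-- Multiplication by an odd integer descends along a surjective homomorphism commuting with
-- Frobenius, and it is the identity on 2-torsion.
lemma Isogenous.isFull_of_sq_trace_eq (hF : ringChar F ≠ 2) {W W' : WeierstrassCurve F}
    [W.IsElliptic] (h : Isogenous W W') (ha : frobeniusTrace W ^ 2 = 4 * Fintype.card F) :
    IsFull W' := by
  have hell : (W.baseChange (AlgebraicClosure F)).IsElliptic :=
    inferInstanceAs (W.map _).IsElliptic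
  obtain ⟨φ, hφ⟩ := h
  obtain ⟨m, ⟨l, rfl⟩, hm⟩ := exists_frob_eq_zsmul W (AlgebraicClosure F) hF ha
  intro Q hQ
  obtain ⟨P, rfl⟩ := hφ.surjective Q
  rw [← hφ.isMorphismOver.frob_comm, hm, map_zsmul, add_zsmul, mul_zsmul', two_zsmul, hQ,
    zsmul_zero, zero_add, one_zsmul]

end Existence

end EllipticIsogeny

theorem mainTheorem9 {F : Type*} [Field F] [Fintype F] [DecidableEq F] (hF : ringChar F ≠ 2)
    (E : WeierstrassCurve F) [E.IsElliptic] (hE : 4 ∣ Nat.card E.toAffine.Point) :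
    (((EllipticIsogeny.frobeniusTrace E : ℝ) ≠ 2 * √(Fintype.card F : ℝ) ∧
        (EllipticIsogeny.frobeniusTrace E : ℝ) ≠ -(2 * √(Fintype.card F : ℝ))) →
      (∃ E' : WeierstrassCurve F, E'.IsElliptic ∧ EllipticIsogeny.Isogenous E E' ∧
        Nonempty (EllipticIsogeny.ratTwoTorsion E' ≃+ ZMod 2)) ∧
      (∃ E'' : WeierstrassCurve F, E''.IsElliptic ∧ EllipticIsogeny.Isogenous E E'' ∧
        Nonempty (EllipticIsogeny.ratTwoTorsion E'' ≃+ ZMod 2 × ZMod 2))) ∧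
    (((EllipticIsogeny.frobeniusTrace E : ℝ) = 2 * √(Fintype.card F : ℝ) ∨
        (EllipticIsogeny.frobeniusTrace E : ℝ) = -(2 * √(Fintype.card F : ℝ))) →
      ∀ E' : WeierstrassCurve F, E'.IsElliptic → EllipticIsogeny.Isogenous E E' →
        Nonempty (EllipticIsogeny.ratTwoTorsion E' ≃+ ZMod 2 × ZMod 2)) := by
  open EllipticIsogeny in
  have key : ((frobeniusTrace E : ℝ) = 2 * √(Fintype.card F : ℝ) ∨
      (frobeniusTrace E : ℝ) = -(2 * √(Fintype.card F : ℝ))) ↔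
        frobeniusTrace E ^ 2 = 4 * Fintype.card F := by
    rw [← sq_eq_sq_iff_eq_or_eq_neg, mul_pow, Real.sq_sqrt (Nat.cast_nonneg _)]
    norm_num
    norm_cast
  refine ⟨fun h ↦ ⟨?_, ?_⟩, fun h E' hE' hiso ↦
    (hiso.isFull_of_sq_trace_eq hF (key.1 h)).nonempty_addEquiv hF⟩
  · obtain ⟨E', hE', hiso, hrat, hfull⟩ := EllipticIsogeny.exists_isogenous_not_isFull hF E
      (EllipticIsogeny.hasRatTwoTorsion_of_two_dvd_card (dvd_trans (by norm_num) hE))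
      fun h' ↦ (key.2 h').elim h.1 h.2
    exact ⟨E', hE', hiso, hrat.nonempty_addEquiv hF hfull⟩
  · obtain ⟨E'', hE'', hiso, hfull⟩ := EllipticIsogeny.exists_isogenous_isFull hF E hE
    exact ⟨E'', hE'', hiso, hfull.nonempty_addEquiv hF⟩
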